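/- **Setting.** Let $(\Omega,\mathcal F,P)$ be a complete probability space, $T\ge 0$, $B$ a standard $d$-dimensional Brownian motion on $[0,T]$, and $(\mathcal F_t)_{t\le T}$ the filtration generated by $B$ augmented by the $P$-null sets, with predictable $\sigma$-algebra $\mathcal P$ on $[0,T]\times\Omega$. Let $\mathcal D$ be the set of real $\mathcal P$-measurable right-continuous processes with left limits ($Y_{0-}:=Y_0$), $\mathcal K$ the set of nondecreasing $K\in\mathcal D$ with $K_0=0$, and $\mathcal L^{2,d}$ the set of $\mathbb R^d$-valued $\mathcal P$-measurable $Z$ with $\int_0^T|Z_s|^2ds<\infty$ a.s. For $K\in\mathcal K$, $dK$ is the Stieltjes measure on $[0,T]$ and $\int_a^b=\int_{]a,b]}$. For $K^1,K^2\in\mathcal K$, $dK^1\perp dK^2$ means that $E\int_0^T 1_D\,dK^1=E\int_0^T1_{D^c}\,dK^2=0$ for some $D\in\mathcal P$. **Data.** $\xi$ is a real $\mathcal F_T$-measurable random variable; $l,u$ are real $\mathcal P$-measurable processes; $L,U\in\mathcal D$; $\alpha,\delta,A\in\mathcal K$; $f:[0,T]\times\Omega\times\mathbb R\times\mathbb R^d\to\mathbb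 R$ and $g:[0,T]\times\Omega\times\mathbb R\times\mathbb R\to\mathbb R$ are such that $f(t,\omega,(L_t\vee y)\wedge U_t,z)$ and $g(t,\omega,(L_{t-}\vee x)\wedge U_{t-},(L_t\vee y)\wedge U_t)$ are $\mathcal P$-measurable in $(t,\omega)$ for all fixed $x,y,z$. Let $Dom$ be the set of $Y\in\mathcal D$ with $$E\Big[\int_0^T(L_{t-}-Y_{t-})^+dt+(l_t-Y_{t-})^+d\delta_t+(U_{t-}-Y_{t-})^-dt+(u_t-Y_{t-})^-d\alpha_t\Big]=0 .$$ **Original equation.** $(Y,Z,K^+,K^-)$ is a solution of the original RBSDE if 1. $Y\in Dom$, $Z\in\mathcal L^{2,d}$, $K^\pm\in\mathcal K$, $dK^+\perp dK^-$; 2. a.s. $\int_0^T|f(s,Y_s,Z_s)|ds+\int_0^T|g(s,Y_{s-},Y_s)|dA_s<\infty$ and, for all $t\le T$, $$Y_t=\xi+\int_t^T\big[f(s,Y_s,Z_s)ds+g(s,Y_{s-},Y_s)dA_s+dK^+_s-dK^-_s-Z_sdB_s\big];$$ 3. for every $L^*\in Dom$, $\;E\int_0^T(Y_{t-}-L^*_{t-})^+dK^+_t+(Y_{t-}-L^*_{t-})^-dK^-_t=0$.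 **Envelopes.** For $h:[0,T]\times\Omega\to\mathbb R$ $\mathcal P$-measurable and $\rho\in\mathcal K$ put, in $[-\infty,+\infty]$ (with $\inf\emptyset=+\infty$), $$h^{*,\rho}(t,\omega)=\inf_{n\in\mathbb N}\Big\{-nt+\inf\Big\{a\in\mathbb R:\int_0^t[h_s(\omega)+ns-a]^+\,d\rho_s(\omega)=0\Big\}\Big\}.$$ **Theorem.** $(Y,Z,K^+,K^-)$ is a solution of the original RBSDE if and only if 1. the backward equation, with the integrability, of item 2 above holds; 2. a.s., for all $t\in\,]0,T]$, $\;L_{t-}\vee l^{*,\delta}(t)\le Y_{t-}\le U_{t-}\wedge\big(-(-u)^{*,\alpha}(t)\big)$; 3. a.s., $\displaystyle\int_0^T\big(Y_{t-}-[L_{t-}\vee l^{*,\delta}(t)]\big)dK^+_t=\int_0^T\big([U_{t-}\wedge(-(-u)^{*,\alpha}(t))]-Y_{t-}\big)dK^-_t=0$; 4. $Y\in\mathcal D$, $K^+,K^-\in\mathcal K$, $Z\in\mathcal L^{2,d}$; 5. $dK^+\perp dK^-$. -/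

import Mathlib

open MeasureTheory ProbabilityTheory Filter Topology Set Function
open scoped ENNReal NNReal

namespace RBSDE

/-! ### Time interval, Brownian motion and its augmented filtration -/

/-- The time interval `[0, T]`. Its least element is `⊥ = 0` and its greatest one is `⊤ = T`. -/
abbrev TimeInterval (T : ℝ) : Type := Set.Icc (0 : ℝ) T

/-- Lebesgue measure `dt` on `[0, T]`. -/
noncomputable def lebesgue (T : ℝ) : Measure (TimeInterval T) :=
  Measure.comap (Subtype.val : TimeInterval T → ℝ) volume

variable {Ω : Type*} [m : MeasurableSpace Ω] {T : ℝ} [Fact (0 ≤ T)] {d : ℕ}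

/-- `B` is a standard `d`-dimensional Brownian motion on `[0, T]`. -/
structure IsBrownianMotion (P : Measure Ω)
    (B : TimeInterval T → Ω → EuclideanSpace ℝ (Fin d)) : Prop where
  measurable : ∀ t, Measurable (B t)
  zero : ∀ᵐ ω ∂P, B ⊥ ω = 0
  indep_increments : HasIndepIncrements B P
  indep_coord : ∀ s t : TimeInterval T, s ≤ t →
    iIndepFun (fun (i : Fin d) (ω : Ω) => B t ω i - B s ω i) P
  law_coord : ∀ s t : TimeInterval T, s ≤ t → ∀ i : Fin d,
    HasLaw (fun ω => B t ω i - B s ω i) (gaussianReal 0 (Real.toNNReal ((t : ℝ) - (s : ℝ)))) P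
  continuous_paths : ∀ᵐ ω ∂P, Continuous fun t => B t ω

/-- The standard augmentation of the filtration generated by `B`:
`F t` is generated by the `B s`, `s ≤ t`, and all `P`-null sets. -/
noncomputable def augmentedFiltration (P : Measure Ω) [P.IsComplete]
    (B : TimeInterval T → Ω → EuclideanSpace ℝ (Fin d)) (hB : ∀ t, Measurable (B t)) :
    Filtration (TimeInterval T) m :=
  Filtration.natural B (fun t => (hB t).stronglyMeasurable) ⊔
    Filtration.const (TimeInterval T) (MeasurableSpace.generateFrom {N : Set Ω | P N = 0})
      (MeasurableSpace.generateFrom_le fun N (hN : P N = 0) => measurableSet_of_null hN)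

/-! ### Classes of processes -/

/-- The left limit `Y_{t-}(ω)`; it is `Y_0(ω)` at time `0`. -/
noncomputable def leftValue (Y : TimeInterval T → Ω → ℝ) (t : TimeInterval T) (ω : Ω) : ℝ :=
  leftLim (fun s => Y s ω) t

/-- The class `𝒟` of predictable real processes that are right continuous with left limits. -/
structure IsD (F : Filtration (TimeInterval T) m) (Y : TimeInterval T → Ω → ℝ) : Prop where
  predictable : IsStronglyPredictable F Y
  right_continuous : ∀ ω t, ContinuousWithinAt (fun s => Y s ω) (Ici t) t
  left_limits : ∀ ω t, ∃ y : ℝ, Tendsto (fun s => Y s ω) (𝓝[<] t) (𝓝 y)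

/-- The class `𝒦` of nondecreasing processes of `𝒟` that vanish at time `0`. -/
structure IsK (F : Filtration (TimeInterval T) m) (K : TimeInterval T → Ω → ℝ) : Prop
    extends IsD F K where
  monotone : ∀ ω, Monotone fun t => K t ω
  zero : ∀ ω, K ⊥ ω = 0

open Classical in
/-- The Lebesgue–Stieltjes measure `dK_t(ω)` on `[0, T]`; it has mass `K_b(ω) - K_a(ω)` on
`]a, b]` and no mass at `0`. (The default value `0` is for paths that are not nondecreasing.) -/
noncomputable def pathMeasure (K : TimeInterval T → Ω → ℝ) (ω : Ω) : Measure (TimeInterval T) :=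
  if h : Monotone fun t => K t ω then h.stieltjesFunction.measure else 0

/-- The class `ℒ^{2,d}` of predictable `ℝ^d`-valued processes with `∫_0^T |Z_s|^2 ds < ∞` a.s. -/
structure IsL2 (P : Measure Ω) (F : Filtration (TimeInterval T) m)
    (Z : TimeInterval T → Ω → EuclideanSpace ℝ (Fin d)) : Prop where
  predictable : IsStronglyPredictable F Z
  sq_integrable : ∀ᵐ ω ∂P, ∫⁻ t, ‖Z t ω‖ₑ ^ 2 ∂(lebesgue T) < ∞

/-- `dK¹ ⊥ dK²`: there is a predictable `D` with `E ∫ 1_D dK¹ = E ∫ 1_{Dᶜ} dK² = 0`. -/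
def Singular (P : Measure Ω) (F : Filtration (TimeInterval T) m)
    (K₁ K₂ : TimeInterval T → Ω → ℝ) : Prop :=
  ∃ D : Set (TimeInterval T × Ω), MeasurableSet[F.predictable] D ∧
    ∫⁻ ω, ∫⁻ t, D.indicator (fun _ => (1 : ℝ≥0∞)) (t, ω) ∂(pathMeasure K₁ ω) ∂P = 0 ∧
    ∫⁻ ω, ∫⁻ t, Dᶜ.indicator (fun _ => (1 : ℝ≥0∞)) (t, ω) ∂(pathMeasure K₂ ω) ∂P = 0

/-! ### The Itô integral -/

/-- A simple integrand `∑ᵢ cᵢ 1_{]aᵢ, bᵢ]}` with `cᵢ` bounded and `F_{aᵢ}`-measurable. -/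
structure SimpleIntegrand (F : Filtration (TimeInterval T) m) (d : ℕ) where
  card : ℕ
  left : Fin card → TimeInterval T
  right : Fin card → TimeInterval T
  left_le_right : ∀ i, left i ≤ right i
  coeff : Fin card → Ω → EuclideanSpace ℝ (Fin d)
  measurable : ∀ i, StronglyMeasurable[F (left i)] (coeff i)
  bounded : ∃ C : ℝ, ∀ i ω, ‖coeff i ω‖ ≤ C

/-- The process `∑ᵢ cᵢ 1_{]aᵢ, bᵢ]}`. -/
noncomputable def SimpleIntegrand.process {F : Filtration (TimeInterval T) m}
    (H : SimpleIntegrand F d) (t : TimeInterval T) (ω : Ω) : EuclideanSpace ℝ (Fin d) :=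
  ∑ i, (Ioc (H.left i) (H.right i)).indicator (fun _ => H.coeff i ω) t

/-- The integral `∑ᵢ ⟨cᵢ, B_{bᵢ ∧ t} - B_{aᵢ ∧ t}⟩` of a simple integrand. -/
noncomputable def SimpleIntegrand.integral {F : Filtration (TimeInterval T) m}
    (H : SimpleIntegrand F d) (B : TimeInterval T → Ω → EuclideanSpace ℝ (Fin d))
    (t : TimeInterval T) (ω : Ω) : ℝ :=
  ∑ i, inner ℝ (H.coeff i ω) (B (min (H.right i) t) ω - B (min (H.left i) t) ω)

/-- `I` is (a version of) the Itô integral process `t ↦ ∫_0^t Z_s dB_s`: a continuous adapted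
process that is the limit, uniformly in time and in probability, of the integrals of simple
integrands `H n` such that `∫_0^T |H n - Z|^2 ds → 0` in probability. For `Z ∈ ℒ^{2,d}` such a
process exists and is unique up to indistinguishability. -/
structure IsItoIntegral (P : Measure Ω) (F : Filtration (TimeInterval T) m)
    (B Z : TimeInterval T → Ω → EuclideanSpace ℝ (Fin d)) (I : TimeInterval T → Ω → ℝ) :
    Prop where
  adapted : StronglyAdapted F I
  continuous_paths : ∀ᵐ ω ∂P, Continuous fun t => I t ω
  approx : ∃ H : ℕ → SimpleIntegrand F d, ∀ ε : ℝ≥0∞, 0 < ε →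
    Tendsto (fun n => P {ω | ε ≤ ∫⁻ t, ‖(H n).process t ω - Z t ω‖ₑ ^ 2 ∂(lebesgue T)})
      atTop (𝓝 0) ∧
    Tendsto (fun n => P {ω | ε ≤ ⨆ t, ‖(H n).integral B t ω - I t ω‖ₑ}) atTop (𝓝 0)

/-! ### Data and the original reflected equation -/

/-- The data `ξ, l, L, u, U, f, g, α, δ, A`. -/
structure Data (F : Filtration (TimeInterval T) m) (d : ℕ) where
  ξ : Ω → ℝ
  l : TimeInterval T → Ω → ℝ
  L : TimeInterval T → Ω → ℝ
  u : TimeInterval T → Ω → ℝ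
  U : TimeInterval T → Ω → ℝ
  f : TimeInterval T → Ω → ℝ → EuclideanSpace ℝ (Fin d) → ℝ
  g : TimeInterval T → Ω → ℝ → ℝ → ℝ
  α : TimeInterval T → Ω → ℝ
  δ : TimeInterval T → Ω → ℝ
  A : TimeInterval T → Ω → ℝ
  measurable_ξ : StronglyMeasurable[F ⊤] ξ
  predictable_l : IsStronglyPredictable F l
  isD_L : IsD F L
  predictable_u : IsStronglyPredictable F u
  isD_U : IsD F U
  predictable_f : ∀ (y : ℝ) (z : EuclideanSpace ℝ (Fin d)),
    IsStronglyPredictable F fun t ω => f t ω (min (max (L t ω) y) (U t ω)) z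
  predictable_g : ∀ x y : ℝ, IsStronglyPredictable F fun t ω =>
    g t ω (min (max (leftValue L t ω) x) (leftValue U t ω)) (min (max (L t ω) y) (U t ω))
  isK_α : IsK F α
  isK_δ : IsK F δ
  isK_A : IsK F A

/-- The set `Dom(l dδ + L dt, u dα + U dt)`: processes `Y ∈ 𝒟` with
`E[∫_0^T (L_{t-} - Y_{t-})⁺ dt + (l_t - Y_{t-})⁺ dδ_t
  + (U_{t-} - Y_{t-})⁻ dt + (u_t - Y_{t-})⁻ dα_t] = 0`. -/
def Data.Dom {F : Filtration (TimeInterval T) m} (D : Data F d) (P : Measure Ω) :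
    Set (TimeInterval T → Ω → ℝ) :=
  {Y | IsD F Y ∧
    ∫⁻ ω, (∫⁻ t, ENNReal.ofReal (leftValue D.L t ω - leftValue Y t ω) ∂(lebesgue T)
      + ∫⁻ t, ENNReal.ofReal (D.l t ω - leftValue Y t ω) ∂(pathMeasure D.δ ω)
      + ∫⁻ t, ENNReal.ofReal (leftValue Y t ω - leftValue D.U t ω) ∂(lebesgue T)
      + ∫⁻ t, ENNReal.ofReal (leftValue Y t ω - D.u t ω) ∂(pathMeasure D.α ω)) ∂P = 0}

/-- The backward equation: the integrals of `f` and `g` converge absolutely and, almost surely,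
for all `t ≤ T`,
`Y_t = ξ + ∫_t^T f(s, Y_s, Z_s) ds + ∫_t^T g(s, Y_{s-}, Y_s) dA_s + ∫_t^T dK⁺_s - ∫_t^T dK⁻_s
  - ∫_t^T Z_s dB_s`. -/
def Data.BackwardEquation {F : Filtration (TimeInterval T) m} (D : Data F d) (P : Measure Ω)
    (B : TimeInterval T → Ω → EuclideanSpace ℝ (Fin d))
    (Y : TimeInterval T → Ω → ℝ) (Z : TimeInterval T → Ω → EuclideanSpace ℝ (Fin d))
    (Kp Km : TimeInterval T → Ω → ℝ) : Prop :=
  (∀ᵐ ω ∂P, Integrable (fun s => D.f s ω (Y s ω) (Z s ω)) (lebesgue T)) ∧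
  (∀ᵐ ω ∂P, Integrable (fun s => D.g s ω (leftValue Y s ω) (Y s ω)) (pathMeasure D.A ω)) ∧
  ∃ I : TimeInterval T → Ω → ℝ, IsItoIntegral P F B Z I ∧
    ∀ᵐ ω ∂P, ∀ t : TimeInterval T,
      Y t ω = D.ξ ω
        + ∫ s in Ioc t ⊤, D.f s ω (Y s ω) (Z s ω) ∂(lebesgue T)
        + ∫ s in Ioc t ⊤, D.g s ω (leftValue Y s ω) (Y s ω) ∂(pathMeasure D.A ω)
        + (Kp ⊤ ω - Kp t ω) - (Km ⊤ ω - Km t ω)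
        - (I ⊤ ω - I t ω)

/-- `(Y, Z, K⁺, K⁻)` is a solution of the original reflected equation, whose minimality condition
is tested against all the processes of `Dom`. -/
structure Data.IsSolution {F : Filtration (TimeInterval T) m} (D : Data F d) (P : Measure Ω)
    (B : TimeInterval T → Ω → EuclideanSpace ℝ (Fin d))
    (Y : TimeInterval T → Ω → ℝ) (Z : TimeInterval T → Ω → EuclideanSpace ℝ (Fin d))
    (Kp Km : TimeInterval T → Ω → ℝ) : Prop where
  mem_dom : Y ∈ D.Dom P
  isL2 : IsL2 P F Z
  isK_plus : IsK F Kp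
  isK_minus : IsK F Km
  singular : Singular P F Kp Km
  equation : D.BackwardEquation P B Y Z Kp Km
  minimality : ∀ L' ∈ D.Dom P,
    ∫⁻ ω, (∫⁻ t, ENNReal.ofReal (leftValue Y t ω - leftValue L' t ω) ∂(pathMeasure Kp ω)
      + ∫⁻ t, ENNReal.ofReal (leftValue L' t ω - leftValue Y t ω) ∂(pathMeasure Km ω)) ∂P = 0

/-! ### Envelopes and the standard doubly reflected equation -/

/-- `ess sup^ρ_{s ≤ t} [h(s, ω) + n s]`, that is
`inf {a ∈ ℝ : ∫_0^t [h(s, ω) + n s - a]⁺ dρ_s(ω) = 0}` (with `inf ∅ = +∞`). -/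
noncomputable def driftedEssSup (h ρ : TimeInterval T → Ω → ℝ) (n : ℕ) (t : TimeInterval T)
    (ω : Ω) : EReal :=
  ⨅ a ∈ {a : ℝ | ∫⁻ s in Ioc ⊥ t, ENNReal.ofReal (h s ω + n * (s : ℝ) - a)
    ∂(pathMeasure ρ ω) = 0}, (a : EReal)

/-- The envelope `h^{*,ρ}(t, ω) = inf_n {-n t + ess sup^ρ_{s ≤ t} [h(s, ω) + n s]}`. -/
noncomputable def envelope (h ρ : TimeInterval T → Ω → ℝ) (t : TimeInterval T) (ω : Ω) : EReal :=
  ⨅ n : ℕ, ((-((n : ℝ) * (t : ℝ)) : ℝ) : EReal) + driftedEssSup h ρ n t ω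

/-- The lower barrier `L_{t-} ∨ l^{*,δ}(t)`. -/
noncomputable def Data.lowerBarrier {F : Filtration (TimeInterval T) m} (D : Data F d)
    (t : TimeInterval T) (ω : Ω) : EReal :=
  max (leftValue D.L t ω : EReal) (envelope D.l D.δ t ω)

/-- The upper barrier `U_{t-} ∧ (-(-u)^{*,α}(t))`. -/
noncomputable def Data.upperBarrier {F : Filtration (TimeInterval T) m} (D : Data F d)
    (t : TimeInterval T) (ω : Ω) : EReal :=
  min (leftValue D.U t ω : EReal) (-envelope (fun s ω' => -D.u s ω') D.α t ω)

/-- `(Y, Z, K⁺, K⁻)` solves the standard doubly reflected equation: its left limits stay between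
the two barriers on `]0, T]` and the usual Skorokhod conditions hold. (The integrands in the
Skorokhod conditions are nonnegative by `barriers`, so their integrals are taken in `[0, ∞]`.) -/
structure Data.IsStandardSolution {F : Filtration (TimeInterval T) m} (D : Data F d)
    (P : Measure Ω) (B : TimeInterval T → Ω → EuclideanSpace ℝ (Fin d))
    (Y : TimeInterval T → Ω → ℝ) (Z : TimeInterval T → Ω → EuclideanSpace ℝ (Fin d))
    (Kp Km : TimeInterval T → Ω → ℝ) : Prop where
  equation : D.BackwardEquation P B Y Z Kp Km
  barriers : ∀ᵐ ω ∂P, ∀ t : TimeInterval T, ⊥ < t →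
    D.lowerBarrier t ω ≤ (leftValue Y t ω : EReal) ∧
    (leftValue Y t ω : EReal) ≤ D.upperBarrier t ω
  skorokhod_plus : ∀ᵐ ω ∂P,
    ∫⁻ t, ((leftValue Y t ω : EReal) - D.lowerBarrier t ω).toENNReal ∂(pathMeasure Kp ω) = 0
  skorokhod_minus : ∀ᵐ ω ∂P,
    ∫⁻ t, (D.upperBarrier t ω - (leftValue Y t ω : EReal)).toENNReal ∂(pathMeasure Km ω) = 0
  isD : IsD F Y
  isK_plus : IsK F Kp
  isK_minus : IsK F Km
  isL2 : IsL2 P F Z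
  singular : Singular P F Kp Km

end RBSDE

set_option linter.unusedSectionVars false

namespace RBSDE

variable {Ω : Type*} [m : MeasurableSpace Ω] {T : ℝ} [Fact (0 ≤ T)] {d : ℕ}

/-! ### Paths with left limits -/

/-! Membership in `Dom` is an almost-everywhere constraint, the barriers constrain every positive
time, and the two agree path by path. Indeed `h ≤ h^{*,ρ}` holds `dρ`-almost everywhere
(`ae_le_envelope`), while `h^{*,ρ} ≤ y_-` on `]0, T]` for every càdlàg `y` with `h ≤ y_-`
`dρ`-almost everywhere (`envelope_le_leftLim`). For `L`, left continuity of `L_-` and `Y_-` upgrades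
`dt`-almost everywhere to all positive times. Hence `mem_Dom_iff_barriers`, the upper barrier being
treated by a change of sign. The Skorokhod conditions then give minimality at once: `dK⁺`-almost
everywhere, `Y_-` is at most the lower barrier, which is at most `L*_-`.

The converse needs competitors, and the barrier itself need not come from one. Fix a time `q` and
rationals `r`, `c`, let `σ` be the first time at which `K⁺` reaches `c`, and let `A` be the event
that `l ≤ r` holds `dδ`-almost everywhere on `]q, σ]`. On `A` one would like to lower `Y` towards `L
∨ r` on that interval, but `A` is not known in advance. The lowering is therefore capped by `N_t =
P(A | F_t)`. Once a violation of `l ≤ r` has been charged by `dδ`, `N` vanishes, so the lowered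
process still respects `l`; on `A`, `N` stays positive, so minimality forces `Y_- ≤ L_- ∨ r`
`dK⁺`-almost everywhere on `]q, σ]`. This is `ae_leftValue_le_max_envelope`; countably many triples
`(q, r, c)` suffice by `ae_le_max_envelope`.

The competitor must be predictable and càdlàg, so `N` has to be continuous. This is the only use of
the Brownian filtration: `exists_isContinuousVersion` first treats continuous functions of finitely
many values of `B` by freezing the past, then passes to all events by Doob's inequality and a
monotone class argument. -/

/-- The path property of `𝒟`: right continuity and existence of left limits. -/
def IsCadlag (y : TimeInterval T → ℝ) : Prop :=
  (∀ t, ContinuousWithinAt y (Ici t) t) ∧ ∀ t, ∃ a : ℝ, Tendsto y (𝓝[<] t) (𝓝 a)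

lemma IsD.isCadlag {F : Filtration (TimeInterval T) m} {Y : TimeInterval T → Ω → ℝ}
    (h : IsD F Y) (ω : Ω) : IsCadlag fun s => Y s ω :=
  ⟨h.right_continuous ω, h.left_limits ω⟩

lemma nhdsLT_neBot {t : TimeInterval T} (ht : ⊥ < t) : (𝓝[<] t).NeBot :=
  nhdsLT_neBot_of_exists_lt ⟨⊥, ht⟩

lemma tendsto_leftLim {y : TimeInterval T → ℝ} {t : TimeInterval T}
    (h : ∃ a : ℝ, Tendsto y (𝓝[<] t) (𝓝 a)) : Tendsto y (𝓝[<] t) (𝓝 (leftLim y t)) :=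
  tendsto_leftLim_of_tendsto h

lemma leftLim_bot (y : TimeInterval T → ℝ) : leftLim y ⊥ = y ⊥ :=
  leftLim_eq_of_isBot isBot_bot

/-- The left limit commutes with continuous operations. -/
lemma leftLim_eq_of_tendsto_of_bot {y : TimeInterval T → ℝ} {t : TimeInterval T} {a : ℝ}
    (h : Tendsto y (𝓝[<] t) (𝓝 a)) (hb : t = ⊥ → y ⊥ = a) : leftLim y t = a := by
  rcases eq_or_lt_of_le (bot_le : ⊥ ≤ t) with rfl | ht
  · rw [leftLim_bot, hb rfl]
  · have := nhdsLT_neBot ht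
    exact leftLim_eq_of_tendsto h

lemma IsCadlag.continuousWithinAt_leftLim {y : TimeInterval T → ℝ} (h : IsCadlag y)
    (t : TimeInterval T) : ContinuousWithinAt (leftLim y) (Iic t) t :=
  continuousWithinAt_leftLim_Iic (tendsto_leftLim (h.2 t))

lemma IsCadlag.leftLim_lt_of_nhdsLT {y : TimeInterval T → ℝ} (h : IsCadlag y)
    {t : TimeInterval T} {a : ℝ} (ht : leftLim y t < a) :
    ∀ᶠ s in 𝓝[≤] t, leftLim y s < a :=
  (h.continuousWithinAt_leftLim t).eventually_lt_const ht

/-- A path with right and left limits is bounded above along its left limits. -/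
lemma IsCadlag.exists_leftLim_le {y : TimeInterval T → ℝ} (h : IsCadlag y) :
    ∃ M, ∀ t, leftLim y t ≤ M := by
  have hloc : ∀ t, ∃ u ∈ 𝓝 t, BddAbove (y '' u) := by
    intro t
    obtain ⟨a, ha⟩ := h.2 t
    have h1 := ha.eventually_lt_const (lt_add_one a)
    have h2 := (h.1 t).eventually_lt_const (lt_add_one (y t))
    refine ⟨{s | y s ≤ max (a + 1) (y t + 1)}, ?_, ⟨max (a + 1) (y t + 1), ?_⟩⟩
    · change ∀ᶠ s in 𝓝 t, y s ≤ max (a + 1) (y t + 1)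
      rw [← nhdsLT_sup_nhdsGE t]
      exact eventually_sup.2 ⟨h1.mono fun s hs => hs.le.trans (le_max_left _ _),
        h2.mono fun s hs => hs.le.trans (le_max_right _ _)⟩
    · rintro _ ⟨s, hs, rfl⟩
      exact hs
  -- One-sided limits bound the path near each time; compactness of `[0, T]` makes the bound global.
  have hb : BddAbove (y '' univ) := by
    refine isCompact_univ.induction_on (p := fun s => BddAbove (y '' s)) (by simp)
      (fun s t hst ht => ht.mono (image_mono hst))
      (fun s t hs ht => by rw [image_union]; exact hs.union ht) fun t _ => ?_
    obtain ⟨u, hu, hu'⟩ := hloc t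
    exact ⟨u, mem_nhdsWithin_of_mem_nhds hu, hu'⟩
  obtain ⟨M, hM⟩ := hb
  have hM' : ∀ t, y t ≤ M := fun t => hM ⟨t, mem_univ _, rfl⟩
  refine ⟨M, fun t => ?_⟩
  rcases eq_or_lt_of_le (bot_le : ⊥ ≤ t) with rfl | ht
  · rw [leftLim_bot]; exact hM' _
  · have := nhdsLT_neBot ht
    exact le_of_tendsto (tendsto_leftLim (h.2 t)) (Eventually.of_forall hM')

lemma leftLim_neg (y : TimeInterval T → ℝ) (t : TimeInterval T)
    (h : ∃ a : ℝ, Tendsto y (𝓝[<] t) (𝓝 a)) : leftLim (fun s => -y s) t = -leftLim y t := by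
  refine leftLim_eq_of_tendsto_of_bot (tendsto_leftLim h).neg ?_
  rintro rfl
  rw [leftLim_bot]

/-! ### Path measures -/

section PathMeasure

variable {F : Filtration (TimeInterval T) m} {K : TimeInterval T → Ω → ℝ}

/-- The Stieltjes function of a monotone path is made of right limits, so right continuity gives
back the path itself. -/
lemma IsK.stieltjes_apply (hK : IsK F K) (ω : Ω) (t : TimeInterval T) :
    (hK.monotone ω).stieltjesFunction t = K t ω := by
  rw [Monotone.stieltjesFunction_eq]
  exact (hK.right_continuous ω t).rightLim_eq

lemma IsK.stieltjes_eq (hK : IsK F K) (ω : Ω) :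
    ((hK.monotone ω).stieltjesFunction : TimeInterval T → ℝ) = fun t => K t ω :=
  funext (hK.stieltjes_apply ω)

lemma IsK.pathMeasure_eq (hK : IsK F K) (ω : Ω) :
    pathMeasure K ω = (hK.monotone ω).stieltjesFunction.measure :=
  dif_pos (hK.monotone ω)

lemma IsK.pathMeasure_Icc (hK : IsK F K) (ω : Ω) (a b : TimeInterval T) :
    pathMeasure K ω (Icc a b) = ENNReal.ofReal (K b ω - leftValue K a ω) := by
  rw [hK.pathMeasure_eq, StieltjesFunction.measure_Icc, hK.stieltjes_eq]
  rfl

lemma IsK.pathMeasure_Iic (hK : IsK F K) (ω : Ω) (b : TimeInterval T) :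
    pathMeasure K ω (Iic b) = ENNReal.ofReal (K b ω) := by
  rw [← Icc_bot, hK.pathMeasure_Icc, leftValue, leftLim_bot, hK.zero, sub_zero]

lemma IsK.pathMeasure_bot (hK : IsK F K) (ω : Ω) : pathMeasure K ω {⊥} = 0 := by
  rw [← Iic_bot, hK.pathMeasure_Iic, hK.zero, ENNReal.ofReal_zero]

lemma IsK.ae_bot_lt (hK : IsK F K) (ω : Ω) : ∀ᵐ t ∂(pathMeasure K ω), ⊥ < t := by
  have : ∀ᵐ t ∂(pathMeasure K ω), t ∉ ({⊥} : Set (TimeInterval T)) :=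
    measure_eq_zero_iff_ae_notMem.1 (hK.pathMeasure_bot ω)
  filter_upwards [this] with t ht
  exact bot_lt_iff_ne_bot.2 ht

lemma IsK.isFiniteMeasure (hK : IsK F K) (ω : Ω) : IsFiniteMeasure (pathMeasure K ω) :=
  ⟨by rw [← Iic_top, hK.pathMeasure_Iic]; exact ENNReal.ofReal_lt_top⟩

end PathMeasure

/-- A set whose order-closed intervals are null is null. -/
lemma measure_eq_zero_of_forall_Icc {μ : Measure (TimeInterval T)} {s : Set (TimeInterval T)}
    (h : ∀ a ∈ s, ∀ b ∈ s, a ≤ b → μ (Icc a b) = 0) : μ s = 0 := by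
  refine measure_null_of_locally_null s fun x hx => ?_
  have hL : ∃ u ∈ 𝓝[s] x, μ (u ∩ Iic x) = 0 := by
    by_cases hx' : ∃ a ∈ s, a < x
    · obtain ⟨a, ha, hax⟩ := hx'
      exact ⟨Ici a, mem_nhdsWithin_of_mem_nhds (Ici_mem_nhds hax), by
        rw [Ici_inter_Iic]; exact h a ha x hx hax.le⟩
    -- With no point of `s` to the left of `x`, only `x` remains, and the interval `Icc x x` rules
    -- out an atom there.
    · push Not at hx'
      refine ⟨s, self_mem_nhdsWithin, measure_mono_null ?_ (h x hx x hx le_rfl)⟩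
      exact fun y hy => ⟨hx' y hy.1, hy.2⟩
  have hR : ∃ u ∈ 𝓝[s] x, μ (u ∩ Ici x) = 0 := by
    by_cases hx' : ∃ a ∈ s, x < a
    · obtain ⟨a, ha, hax⟩ := hx'
      exact ⟨Iic a, mem_nhdsWithin_of_mem_nhds (Iic_mem_nhds hax), by
        rw [inter_comm, Ici_inter_Iic]; exact h x hx a ha hax.le⟩
    · push Not at hx'
      refine ⟨s, self_mem_nhdsWithin, measure_mono_null ?_ (h x hx x hx le_rfl)⟩
      exact fun y hy => ⟨hy.2, hx' y hy.1⟩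
  obtain ⟨u, hu, hu'⟩ := hL
  obtain ⟨v, hv, hv'⟩ := hR
  refine ⟨u ∩ v, inter_mem hu hv, measure_mono_null ?_ (measure_union_null hu' hv')⟩
  intro y hy
  rcases le_total y x with hyx | hyx
  · exact Or.inl ⟨hy.1, hyx⟩
  · exact Or.inr ⟨hy.2, hyx⟩

lemma lebesgue_Ioo_pos {s t : TimeInterval T} (hst : s < t) : 0 < lebesgue T (Ioo s t) := by
  rw [lebesgue, (MeasurableEmbedding.subtype_coe measurableSet_Icc).comap_apply]
  have : Subtype.val '' Ioo s t = Ioo (s : ℝ) t := by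
    ext x
    constructor
    · rintro ⟨y, hy, rfl⟩
      exact hy
    · intro hx
      exact ⟨⟨x, s.2.1.trans hx.1.le, hx.2.le.trans t.2.2⟩, hx, rfl⟩
  rw [this, Real.volume_Ioo]
  exact ENNReal.ofReal_pos.2 (sub_pos.2 hst)

lemma lebesgue_bot_lt : ∀ᵐ t ∂(lebesgue T), (⊥ : TimeInterval T) < t := by
  have : lebesgue T {(⊥ : TimeInterval T)} = 0 := by
    rw [lebesgue, (MeasurableEmbedding.subtype_coe measurableSet_Icc).comap_apply]
    simp
  filter_upwards [measure_eq_zero_iff_ae_notMem.1 this] with t ht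
  exact bot_lt_iff_ne_bot.2 ht

/-- Two paths whose left limits are ordered almost everywhere are ordered after time `0`. -/
lemma leftLim_le_of_ae {x y : TimeInterval T → ℝ} (hx : IsCadlag x) (hy : IsCadlag y)
    (h : ∀ᵐ t ∂(lebesgue T), leftLim x t ≤ leftLim y t) {t : TimeInterval T} (ht : ⊥ < t) :
    leftLim x t ≤ leftLim y t := by
  -- Lebesgue measure charges every open interval, so the inequality holds at times accumulating at
  -- `t` from the left; left continuity of the left limits concludes.
  have hfr : ∃ᶠ s in 𝓝[<] t, leftLim x s ≤ leftLim y s := by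
    intro hev
    obtain ⟨a, hat, ha⟩ := (mem_nhdsLT_iff_exists_Ioo_subset' ht).1 hev
    have h0 : lebesgue T (Ioo a t) = 0 := measure_mono_null ha h
    exact (lebesgue_Ioo_pos hat).ne' h0
  have hx' := (hx.continuousWithinAt_leftLim t).mono Iio_subset_Iic_self
  have hy' := (hy.continuousWithinAt_leftLim t).mono Iio_subset_Iic_self
  exact le_of_tendsto_of_tendsto_of_frequently hx' hy' hfr

/-! ### The envelope along a path -/

/-- The times `t > q` such that `h ≤ r` holds `dρ`-almost everywhere on `]q, t]`. -/
def window (h ρ : TimeInterval T → Ω → ℝ) (q : TimeInterval T) (r : ℝ) (ω : Ω) :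
    Set (TimeInterval T) :=
  {t | q < t ∧ pathMeasure ρ ω {s | s ∈ Ioc q t ∧ r < h s ω} = 0}

/-- A countable dense sequence of times. -/
noncomputable def timeSeq (T : ℝ) [Fact (0 ≤ T)] : ℕ → TimeInterval T :=
  TopologicalSpace.denseSeq (TimeInterval T)

lemma exists_timeSeq_mem_Ioo {s t : TimeInterval T} (hst : s < t) :
    ∃ k, timeSeq T k ∈ Ioo s t := by
  have hd := TopologicalSpace.denseRange_denseSeq (TimeInterval T)
  obtain ⟨x, hx⟩ := exists_between hst
  obtain ⟨_, hy, k, rfl⟩ := hd.inter_open_nonempty (Ioo s t) isOpen_Ioo ⟨x, hx⟩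
  exact ⟨k, hy⟩

section Envelope

variable {F : Filtration (TimeInterval T) m} {h ρ : TimeInterval T → Ω → ℝ} {ω : Ω}

/-- Some drift `n` and constant `a` give `h s ≤ a - n s` almost everywhere up to `t`, and this line
is below `x` at `t`. By continuity it is already below a rational `r < x` at some `q < t`, and it
decreases afterwards, so `h ≤ r` on `]q, t]`. -/
lemma exists_mem_window_of_envelope_lt (hh : Measurable fun s => h s ω)
    {t : TimeInterval T} (ht : ⊥ < t) {x : ℝ} (hx : envelope h ρ t ω < (x : EReal)) :
    ∃ k : ℕ, ∃ r : ℚ, (r : ℝ) < x ∧ t ∈ window h ρ (timeSeq T k) r ω := by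
  obtain ⟨n, hn⟩ := iInf_lt_iff.1 hx
  have hE : driftedEssSup h ρ n t ω < ((x + n * (t : ℝ) : ℝ) : EReal) := by
    induction hD : driftedEssSup h ρ n t ω with
    | bot => exact EReal.bot_lt_coe _
    | top =>
      rw [hD, EReal.coe_add_top] at hn
      exact absurd hn not_top_lt
    | coe e =>
      rw [hD] at hn
      norm_cast at hn ⊢
      linarith
  obtain ⟨a, ha⟩ := iInf_lt_iff.1 hE
  obtain ⟨haS, hax⟩ := iInf_lt_iff.1 ha
  have hax' : a - n * (t : ℝ) < x := by
    have := EReal.coe_lt_coe_iff.1 hax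
    linarith
  obtain ⟨r, hr1, hr2⟩ := exists_rat_btwn hax'
  have hcont : ContinuousAt (fun s : TimeInterval T => a - n * (s : ℝ)) t := by fun_prop
  have hev : ∀ᶠ s : TimeInterval T in 𝓝[<] t, a - n * (s : ℝ) < r :=
    (hcont.eventually_lt_const hr1).filter_mono nhdsWithin_le_nhds
  obtain ⟨q₀, hq₀, hq₀'⟩ := (mem_nhdsLT_iff_exists_Ioo_subset' ht).1 hev
  obtain ⟨k, hk⟩ := exists_timeSeq_mem_Ioo hq₀
  refine ⟨k, r, hr2, hk.2, ?_⟩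
  have hk' : a - n * (timeSeq T k : ℝ) < r := hq₀' hk
  have hmeas : Measurable fun s : TimeInterval T =>
      ENNReal.ofReal (h s ω + n * (s : ℝ) - a) := by fun_prop
  have hae := (ae_restrict_iff' measurableSet_Ioc).1 ((lintegral_eq_zero_iff hmeas).1 haS)
  refine measure_mono_null ?_ hae
  rintro s ⟨hs, hrs⟩ hcon
  have h1 := hcon ⟨bot_le.trans_lt hs.1, hs.2⟩
  have h2 : h s ω + n * (s : ℝ) - a ≤ 0 := ENNReal.ofReal_eq_zero.1 h1
  have h3 : (n : ℝ) * (timeSeq T k : ℝ) ≤ n * (s : ℝ) :=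
    mul_le_mul_of_nonneg_left hs.1.le (Nat.cast_nonneg n)
  linarith

/-- Any two points `a ≤ b` of the window span an interval contained in `]q, b]`, where `h > r` is
null; `measure_eq_zero_of_forall_Icc` then avoids discussing whether the window contains its right
end. -/
lemma measure_window_inter_lt_eq_zero (hh : Measurable fun s => h s ω) (q : TimeInterval T)
    (r : ℝ) : pathMeasure ρ ω {t | t ∈ window h ρ q r ω ∧ r < h t ω} = 0 := by
  have hm : MeasurableSet {t | r < h t ω} := measurableSet_lt measurable_const hh
  have : (pathMeasure ρ ω).restrict {t | r < h t ω} (window h ρ q r ω) = 0 := by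
    refine measure_eq_zero_of_forall_Icc fun a ha b hb _ => ?_
    rw [Measure.restrict_apply measurableSet_Icc]
    exact measure_mono_null (fun s hs => show s ∈ {s | s ∈ Ioc q b ∧ r < h s ω} from
      ⟨⟨ha.1.trans_le hs.1.1, hs.1.2⟩, hs.2⟩) hb.2
  rwa [Measure.restrict_apply' hm] at this

/-- A time at which the envelope is below `h` lies in one of countably many windows, at a point
where `h` exceeds the level of that window. -/
lemma ae_le_envelope (hρ : IsK F ρ) (hh : Measurable fun s => h s ω) :
    ∀ᵐ t ∂(pathMeasure ρ ω), (h t ω : EReal) ≤ envelope h ρ t ω := by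
  have hnull : ∀ᵐ t ∂(pathMeasure ρ ω), ∀ (k : ℕ) (r : ℚ),
      ¬ (t ∈ window h ρ (timeSeq T k) r ω ∧ (r : ℝ) < h t ω) :=
    ae_all_iff.2 fun k => ae_all_iff.2 fun r =>
      measure_eq_zero_iff_ae_notMem.1 (measure_window_inter_lt_eq_zero hh _ _)
  filter_upwards [hnull, hρ.ae_bot_lt ω] with t ht htb
  by_contra hcon
  push Not at hcon
  obtain ⟨k, r, hr, hw⟩ := exists_mem_window_of_envelope_lt hh htb hcon
  exact ht k r ⟨hw, hr⟩

/-- For `z > y_{t-}`, left continuity keeps `y_- < z` on some `]q, t]`. Before `q` only a global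
bound `M` is known, but a drift `n` with `M - z ≤ n (t - q)` absorbs the excess. -/
lemma envelope_le_leftLim {y : TimeInterval T → ℝ} (hy : IsCadlag y)
    (hle : ∀ᵐ s ∂(pathMeasure ρ ω), h s ω ≤ leftLim y s) {t : TimeInterval T} (ht : ⊥ < t) :
    envelope h ρ t ω ≤ ((leftLim y t : ℝ) : EReal) := by
  refine EReal.le_of_forall_lt_iff_le.1 fun z hz => ?_
  have hz' : leftLim y t < z := EReal.coe_lt_coe_iff.1 hz
  have hev := (hy.leftLim_lt_of_nhdsLT hz')
  obtain ⟨q, hqt, hq⟩ := (mem_nhdsLE_iff_exists_Ioc_subset' ht).1 hev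
  obtain ⟨M, hM⟩ := hy.exists_leftLim_le
  obtain ⟨n, hn⟩ := exists_nat_ge ((M - z) / ((t : ℝ) - q))
  have hqt' : (0 : ℝ) < t - q := sub_pos.2 hqt
  have hn' : M - z ≤ n * ((t : ℝ) - q) := (div_le_iff₀ hqt').1 hn
  have hE : driftedEssSup h ρ n t ω ≤ ((z + n * (t : ℝ) : ℝ) : EReal) := by
    refine iInf₂_le (z + n * (t : ℝ)) ?_
    rw [mem_ofPred_eq, ← lintegral_zero (μ := (pathMeasure ρ ω).restrict (Ioc ⊥ t))]
    refine lintegral_congr_ae ((ae_restrict_iff' measurableSet_Ioc).2 ?_)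
    filter_upwards [hle] with s hs hst
    refine ENNReal.ofReal_eq_zero.2 ?_
    rcases le_or_gt s q with hsq | hsq
    · have h1 := hM s
      have h2 : (n : ℝ) * (s : ℝ) ≤ n * q := mul_le_mul_of_nonneg_left hsq (Nat.cast_nonneg n)
      linarith
    · have h1 : leftLim y s < z := hq ⟨hsq, hst.2⟩
      have h2 : (n : ℝ) * (s : ℝ) ≤ n * t := mul_le_mul_of_nonneg_left hst.2 (Nat.cast_nonneg n)
      linarith
  refine (iInf_le _ n).trans ((add_le_add_right hE _).trans ?_)
  norm_cast
  linarith

/-- Each essential supremum is nondecreasing in `t`, hence Borel, and the envelope is a countable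
infimum. -/
lemma measurable_envelope : Measurable fun t => envelope h ρ t ω := by
  refine Measurable.iInf fun n => ?_
  have h1 : Measurable fun t : TimeInterval T =>
      ((-((n : ℝ) * (t : ℝ)) : ℝ) : EReal) := by fun_prop
  have h2 : Monotone fun t => driftedEssSup h ρ n t ω := by
    intro s t hst
    refine le_iInf₂ fun a ha => iInf₂_le a ?_
    exact le_antisymm ((lintegral_mono_set (Ioc_subset_Ioc_right hst)).trans ha.le) bot_le
  exact h1.add h2.measurable

/-- The two barriers `L` and `h^{*,ρ}` lie below `y_-` at all positive times exactly when `L_-` does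
`dt`-almost everywhere and `h` does `dρ`-almost everywhere. -/
lemma ae_le_iff_max_envelope_le (hρ : IsK F ρ) (hh : Measurable fun s => h s ω)
    {y x : TimeInterval T → ℝ} (hy : IsCadlag y) (hx : IsCadlag x) :
    ((∀ᵐ t ∂(lebesgue T), leftLim x t ≤ leftLim y t) ∧
      ∀ᵐ t ∂(pathMeasure ρ ω), h t ω ≤ leftLim y t) ↔
    ∀ t, ⊥ < t → max ((leftLim x t : ℝ) : EReal) (envelope h ρ t ω) ≤ ((leftLim y t : ℝ) : EReal) := by
  constructor
  · rintro ⟨h1, h2⟩ t ht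
    exact max_le (EReal.coe_le_coe_iff.2 (leftLim_le_of_ae hx hy h1 ht))
      (envelope_le_leftLim hy h2 ht)
  · intro H
    constructor
    · filter_upwards [lebesgue_bot_lt] with t ht
      exact EReal.coe_le_coe_iff.1 ((le_max_left _ _).trans (H t ht))
    · filter_upwards [hρ.ae_bot_lt ω, ae_le_envelope hρ hh] with t ht hle
      exact EReal.coe_le_coe_iff.1 (hle.trans ((le_max_right _ _).trans (H t ht)))

end Envelope

/-- Criterion for `y ≤ x_- ∨ h^{*,ρ}` to hold `dK`-almost everywhere: it suffices that for all
`q`, `r`, `c` such that `h ≤ r` holds `dρ`-almost everywhere on `]q, σ]`, where `σ` is the first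
time at which `K` reaches `c`, one has `y ≤ x ∨ r` on `]q, σ]`, `dK`-almost everywhere. -/
lemma ae_le_max_envelope {F : Filtration (TimeInterval T) m} {h ρ K : TimeInterval T → Ω → ℝ}
    {ω : Ω} (hK : IsK F K) (hh : Measurable fun s => h s ω) {x y : TimeInterval T → ℝ}
    (H : ∀ (k : ℕ) (r c : ℚ),
      pathMeasure ρ ω {s | (timeSeq T k < s ∧ ∀ s' < s, K s' ω < c) ∧ (r : ℝ) < h s ω} = 0 →
      ∀ᵐ t ∂(pathMeasure K ω), timeSeq T k < t ∧ (∀ s' < t, K s' ω < c) →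
        y t ≤ max (x t) r) :
    ∀ᵐ t ∂(pathMeasure K ω), (y t : EReal) ≤ max (x t : EReal) (envelope h ρ t ω) := by
  -- A window need not end at a time defined through `K`. It can be replaced by an interval that
  -- does whenever `K` increases between `t-` and some later point `s` of the window: the first time
  -- at which `K` reaches an intermediate level `c` lies in `[t, s]`.
  have hstay : ∀ᵐ t ∂(pathMeasure K ω), ∀ (k : ℕ) (r : ℚ),
      t ∈ window h ρ (timeSeq T k) r ω → ∃ s ∈ window h ρ (timeSeq T k) r ω, t ≤ s ∧
        ∃ c : ℚ, leftValue K t ω < c ∧ c ≤ K s ω := by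
    refine ae_all_iff.2 fun k => ae_all_iff.2 fun r => ?_
    refine measure_mono_null (t := {t | t ∈ window h ρ (timeSeq T k) r ω ∧
      ∀ s ∈ window h ρ (timeSeq T k) r ω, t ≤ s → K s ω ≤ leftValue K t ω}) ?_ ?_
    · intro t ht
      simp only [mem_compl_iff, mem_ofPred_eq, Classical.not_imp] at ht
      refine ⟨ht.1, fun s hs hts => ?_⟩
      by_contra hcon
      push Not at hcon
      obtain ⟨c, hc1, hc2⟩ := exists_rat_btwn hcon
      exact ht.2 ⟨s, hs, hts, c, hc1, hc2.le⟩
    -- For exceptional `a ≤ b` one has `K_b ≤ K_{a-}`, so `[a, b]` carries no `dK` mass.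
    · refine measure_eq_zero_of_forall_Icc fun a ha b hb hab => ?_
      rw [hK.pathMeasure_Icc, ENNReal.ofReal_eq_zero]
      linarith [ha.2 b hb.1 hab]
  have hall : ∀ᵐ t ∂(pathMeasure K ω), ∀ (k : ℕ) (r c : ℚ),
      pathMeasure ρ ω {s | (timeSeq T k < s ∧ ∀ s' < s, K s' ω < c) ∧ (r : ℝ) < h s ω} = 0 →
      timeSeq T k < t ∧ (∀ s' < t, K s' ω < c) → y t ≤ max (x t) r := by
    refine ae_all_iff.2 fun k => ae_all_iff.2 fun r => ae_all_iff.2 fun c => ?_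
    by_cases hc : pathMeasure ρ ω
      {s | (timeSeq T k < s ∧ ∀ s' < s, K s' ω < c) ∧ (r : ℝ) < h s ω} = 0
    · filter_upwards [H k r c hc] with t ht _ using ht
    · exact Eventually.of_forall fun t h' => absurd h' hc
  filter_upwards [hstay, hall, hK.ae_bot_lt ω] with t h1 h2 ht
  by_contra hcon
  push Not at hcon
  obtain ⟨hcx, hce⟩ := max_lt_iff.1 hcon
  obtain ⟨k, r, hr, hw⟩ := exists_mem_window_of_envelope_lt hh ht hce
  obtain ⟨s, hs, hts, c, hc1, hc2⟩ := h1 k r hw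
  have hlt : ∀ s' < t, K s' ω < c := fun s' hs' =>
    ((hK.monotone ω).le_leftLim hs').trans_lt hc1
  -- Since `c ≤ K s ω`, the interval on which `K` has not yet reached `c` does not go beyond `s`, so
  -- it stays inside the window.
  have hnull : pathMeasure ρ ω
      {s | (timeSeq T k < s ∧ ∀ s' < s, K s' ω < c) ∧ (r : ℝ) < h s ω} = 0 := by
    refine measure_mono_null (fun u hu => ?_) hs.2
    refine ⟨⟨hu.1.1, ?_⟩, hu.2⟩
    by_contra hsu
    push Not at hsu
    exact absurd (hu.1.2 s hsu) (not_lt.2 hc2)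
  have := h2 k r c hnull ⟨hw.1, hlt⟩
  exact absurd this (not_le.2 (max_lt (EReal.coe_lt_coe_iff.1 hcx) hr))

/-! ### Joint measurability -/

/-- Integrals against a measurable family of finite measures on `[0, T]` depend measurably on the
parameter. -/
lemma measurable_lintegral_of_measurable_Iic {X : Type*} [MeasurableSpace X]
    {μ : X → Measure (TimeInterval T)} (hfin : ∀ x, IsFiniteMeasure (μ x))
    (hμ : ∀ b, Measurable fun x => μ x (Iic b)) {f : TimeInterval T → X → ℝ≥0∞}
    (hf : Measurable (uncurry f)) : Measurable fun x => ∫⁻ s, f s x ∂(μ x) := by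
  have huniv : Measurable fun x => μ x univ := by simpa using hμ ⊤
  have hmeas : Measurable μ :=
    Measurable.measure_of_isPiSystem
      ((BorelSpace.measurable_eq (α := TimeInterval T)).trans
        (borel_eq_generateFrom_Iic (TimeInterval T)))
      isPiSystem_Iic (by rintro _ ⟨b, rfl⟩; exact hμ b) huniv
  -- A finite kernel requires a bound on the masses uniform in the parameter. Dividing by one plus
  -- the total mass provides it, and the factor is restored at the end.
  have hc : Measurable fun x => (1 + μ x univ)⁻¹ := (huniv.const_add 1).inv
  have hν : Measurable fun x => (1 + μ x univ)⁻¹ • μ x := by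
    refine Measure.measurable_of_measurable_coe _ fun s hs => ?_
    simp only [Measure.smul_apply, smul_eq_mul]
    exact hc.mul ((Measure.measurable_coe hs).comp hmeas)
  let κ : Kernel X (TimeInterval T) := ⟨fun x => (1 + μ x univ)⁻¹ • μ x, hν⟩
  have hκ : IsFiniteKernel κ := by
    refine ⟨1, ENNReal.one_lt_top, fun x => ?_⟩
    change (1 + μ x univ)⁻¹ * μ x univ ≤ 1
    refine (mul_le_mul_right (le_add_self : μ x univ ≤ 1 + μ x univ) _).trans ?_
    exact ENNReal.inv_mul_le_one _
  have hint : Measurable fun x => ∫⁻ s, f s x ∂(κ x) :=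
    Measurable.lintegral_kernel_prod_right (f := fun x s => f s x) (hf.comp measurable_swap)
  have heq : (fun x => ∫⁻ s, f s x ∂(μ x)) =
      fun x => (1 + μ x univ) * ∫⁻ s, f s x ∂(κ x) := by
    funext x
    change _ = (1 + μ x univ) * ∫⁻ s, f s x ∂((1 + μ x univ)⁻¹ • μ x)
    rw [lintegral_smul_measure, smul_eq_mul, ← mul_assoc, ENNReal.mul_inv_cancel, one_mul]
    · simp
    · exact ENNReal.add_ne_top.2 ⟨ENNReal.one_ne_top, measure_ne_top _ _⟩
  rw [heq]
  exact (huniv.const_add 1).mul hint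

lemma measurableSet_measure_eq_zero {X : Type*} [MeasurableSpace X]
    {μ : X → Measure (TimeInterval T)} (hfin : ∀ x, IsFiniteMeasure (μ x))
    (hμ : ∀ b, Measurable fun x => μ x (Iic b)) {S : Set (TimeInterval T × X)}
    (hS : MeasurableSet S) : MeasurableSet {x | μ x {s | (s, x) ∈ S} = 0} := by
  have h := measurable_lintegral_of_measurable_Iic hfin hμ (f := fun s x => S.indicator 1 (s, x))
    (measurable_one.indicator hS)
  have heq : ∀ x, ∫⁻ s, S.indicator 1 (s, x) ∂(μ x) = μ x {s | (s, x) ∈ S} := fun x =>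
    lintegral_indicator_one (s := {s | (s, x) ∈ S}) (measurable_prodMk_right hS)
  simp only [heq] at h
  exact h (measurableSet_singleton 0)

/-- The process stopped at each time `t` is jointly measurable with respect to `F t`. -/
def IsProgressive (F : Filtration (TimeInterval T) m) (u : TimeInterval T → Ω → ℝ) : Prop :=
  ∀ t : TimeInterval T, @Measurable _ _ ((inferInstance : MeasurableSpace (TimeInterval T)).prod
    (F t)) _ fun p : TimeInterval T × Ω => u (min p.1 t) p.2

section Progressive

variable {F : Filtration (TimeInterval T) m} {u v K : TimeInterval T → Ω → ℝ}

lemma isProgressive_of_predictable (hu : IsStronglyPredictable F u) : IsProgressive F u := by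
  intro t
  let : MeasurableSpace Ω := F t
  have h := (hu.isStronglyProgressive t).measurable
  have hφ : Measurable fun p : TimeInterval T × Ω =>
      ((⟨min p.1 t, mem_Iic.2 (min_le_right _ _)⟩ : Iic t), p.2) :=
    ((measurable_fst.min measurable_const).subtype_mk).prodMk measurable_snd
  exact h.comp hφ

/-- The time `n s / (n + 1)`, just before `s`. -/
noncomputable def shrink (n : ℕ) (s : TimeInterval T) : TimeInterval T :=
  ⟨(n / (n + 1) : ℝ) * s, by
    have h1 : (n / (n + 1) : ℝ) ≤ 1 := by
      rw [div_le_one (by positivity)]; linarith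
    exact ⟨mul_nonneg (by positivity) s.2.1,
      (mul_le_of_le_one_left s.2.1 h1).trans s.2.2⟩⟩

lemma shrink_le (n : ℕ) (s : TimeInterval T) : shrink n s ≤ s := by
  have h1 : (n / (n + 1) : ℝ) ≤ 1 := by
    rw [div_le_one (by positivity)]; linarith
  exact Subtype.coe_le_coe.1 (mul_le_of_le_one_left s.2.1 h1)

lemma shrink_lt (n : ℕ) {s : TimeInterval T} (hs : ⊥ < s) : shrink n s < s := by
  have h1 : (n / (n + 1) : ℝ) < 1 := by
    rw [div_lt_one (by positivity)]; linarith
  have hs' : (0 : ℝ) < s := hs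
  exact Subtype.coe_lt_coe.1 (mul_lt_of_lt_one_left hs' h1)

lemma measurable_shrink (n : ℕ) : Measurable (shrink n : TimeInterval T → TimeInterval T) := by
  refine Measurable.subtype_mk ?_
  fun_prop

lemma tendsto_shrink (s : TimeInterval T) : Tendsto (fun n => shrink n s) atTop (𝓝 s) := by
  refine tendsto_subtype_rng.2 ?_
  have := (tendsto_natCast_div_add_atTop (1 : ℝ)).mul_const (s : ℝ)
  rwa [one_mul] at this

/-- At positive times `shrink n s` approaches `s` strictly from the left; at time `0` it stays
there, in accordance with the convention `Y_{0-} = Y_0`. -/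
lemma tendsto_leftValue (hu : ∀ ω t, ∃ y : ℝ, Tendsto (fun s => u s ω) (𝓝[<] t) (𝓝 y))
    (s : TimeInterval T) (ω : Ω) :
    Tendsto (fun n => u (shrink n s) ω) atTop (𝓝 (leftValue u s ω)) := by
  rcases eq_or_lt_of_le (bot_le : ⊥ ≤ s) with rfl | hs
  · have : ∀ n, shrink n (⊥ : TimeInterval T) = ⊥ := fun n => le_bot_iff.1 (shrink_le n ⊥)
    simp only [this, leftValue, leftLim_bot]
    exact tendsto_const_nhds
  · exact (tendsto_leftLim (hu ω s)).comp (tendsto_nhdsWithin_iff.2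
      ⟨tendsto_shrink s, Eventually.of_forall fun n => shrink_lt n hs⟩)

/-- `shrink` never moves forward, so the approximations of a value before `t` only use values before
`t`. This is why left limits of processes of `𝒟` are progressive. -/
lemma measurable_of_tendsto_shrink {X : Type*} [MeasurableSpace X] {w w' : TimeInterval T → X → ℝ}
    {t : TimeInterval T} (hw : Measurable fun p : TimeInterval T × X => w (min p.1 t) p.2)
    (hlim : ∀ s x, Tendsto (fun n => w (shrink n s) x) atTop (𝓝 (w' s x))) :
    Measurable fun p : TimeInterval T × X => w' (min p.1 t) p.2 := by
  refine measurable_of_tendsto_metrizable (f := fun n (p : TimeInterval T × X) =>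
    w (shrink n (min p.1 t)) p.2) (fun n => ?_) (tendsto_pi_nhds.2 fun p => hlim _ _)
  have hφ : Measurable fun p : TimeInterval T × X => (shrink n (min p.1 t), p.2) :=
    ((measurable_shrink n).comp (measurable_fst.min measurable_const)).prodMk measurable_snd
  have h := hw.comp hφ
  have heq : ∀ p : TimeInterval T × X, min (shrink n (min p.1 t)) t = shrink n (min p.1 t) :=
    fun p => min_eq_left ((shrink_le n _).trans (min_le_right _ _))
  simpa only [Function.comp_def, heq] using h

lemma IsD.isProgressive_leftValue (hu : IsD F u) : IsProgressive F (leftValue u) := fun t =>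
  @measurable_of_tendsto_shrink T _ Ω (F t) _ _ t (isProgressive_of_predictable hu.predictable t)
    (tendsto_leftValue hu.left_limits)

/-- A progressive process is jointly measurable. -/
lemma IsProgressive.measurable_uncurry (hu : IsProgressive F u) : Measurable (uncurry u) := by
  have h := hu ⊤
  simp only [min_top_right] at h
  exact h.mono (sup_le_sup le_rfl (MeasurableSpace.comap_mono (F.le ⊤))) le_rfl

lemma IsProgressive.measurable_path (hu : IsProgressive F u) (ω : Ω) :
    Measurable fun s => u s ω :=
  hu.measurable_uncurry.comp measurable_prodMk_right

/-- Restricting `dK` to `[0, t]` replaces `K_b` by `K_{b ∧ t}`, which is known at time `t`. -/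
lemma IsK.measurable_Iic (hK : IsK F K) (t b : TimeInterval T) :
    Measurable[F t] fun ω => (pathMeasure K ω).restrict (Iic t) (Iic b) := by
  have : (fun ω => (pathMeasure K ω).restrict (Iic t) (Iic b)) =
      fun ω => ENNReal.ofReal (K (min b t) ω) := by
    funext ω
    rw [Measure.restrict_apply measurableSet_Iic, Iic_inter_Iic, hK.pathMeasure_Iic]
  rw [this]
  have h := (hK.predictable.stronglyAdapted (min b t)).measurable
  exact ENNReal.measurable_ofReal.comp (h.mono (F.mono (min_le_right b t)) le_rfl)

/-- For a set `S` whose traces on `[0, t] × Ω` are measurable with respect to `F t`, the event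
that `S` is `dK`-null before `t` belongs to `F t`. -/
lemma IsK.measurableSet_null (hK : IsK F K) (t : TimeInterval T) {S : Set (TimeInterval T × Ω)}
    (hS : MeasurableSet[(inferInstance : MeasurableSpace (TimeInterval T)).prod (F t)]
      {p : TimeInterval T × Ω | (min p.1 t, p.2) ∈ S}) :
    MeasurableSet[F t] {ω | pathMeasure K ω {s | s ≤ t ∧ (s, ω) ∈ S} = 0} := by
  have h := @measurableSet_measure_eq_zero T _ Ω (F t)
    (fun ω => (pathMeasure K ω).restrict (Iic t))
    (fun ω => have := hK.isFiniteMeasure ω; inferInstance) (hK.measurable_Iic t) _ hS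
  convert h using 3 with ω
  rw [Measure.restrict_apply' measurableSet_Iic]
  suffices hset : {s | s ≤ t ∧ (s, ω) ∈ S} =
      {s | (s, ω) ∈ {p : TimeInterval T × Ω | (min p.1 t, p.2) ∈ S}} ∩ Iic t by rw [hset]
  ext s
  constructor
  · rintro ⟨h1, h2⟩
    refine ⟨?_, h1⟩
    simpa only [mem_ofPred_eq, min_eq_left h1] using h2
  · rintro ⟨h1, h2⟩
    have h2' : s ≤ t := h2
    refine ⟨h2', ?_⟩
    simpa only [mem_ofPred_eq, min_eq_left h2'] using h1

lemma IsK.measurable_lintegral (hK : IsK F K) {f : TimeInterval T → Ω → ℝ≥0∞}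
    (hf : Measurable (uncurry f)) : Measurable fun ω => ∫⁻ s, f s ω ∂(pathMeasure K ω) := by
  refine measurable_lintegral_of_measurable_Iic (fun ω => hK.isFiniteMeasure ω) (fun b => ?_) hf
  simp only [hK.pathMeasure_Iic]
  exact ENNReal.measurable_ofReal.comp
    ((hK.predictable.stronglyAdapted b).measurable.mono (F.le b) le_rfl)

lemma measurable_ofReal_sub (hu : IsProgressive F u) (hv : IsProgressive F v) :
    Measurable (uncurry fun t ω => ENNReal.ofReal (u t ω - v t ω)) :=
  ENNReal.measurable_ofReal.comp (hu.measurable_uncurry.sub hv.measurable_uncurry)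

lemma lintegral_lintegral_sub_eq_zero_iff {P : Measure Ω} {μ : Ω → Measure (TimeInterval T)}
    (hu : IsProgressive F u) (hv : IsProgressive F v)
    (hm : Measurable fun ω => ∫⁻ t, ENNReal.ofReal (u t ω - v t ω) ∂(μ ω)) :
    ∫⁻ ω, ∫⁻ t, ENNReal.ofReal (u t ω - v t ω) ∂(μ ω) ∂P = 0 ↔
      ∀ᵐ ω ∂P, ∀ᵐ t ∂(μ ω), u t ω ≤ v t ω := by
  rw [lintegral_eq_zero_iff hm]
  refine eventually_congr (Eventually.of_forall fun ω => ?_)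
  have h1 : Measurable fun t => ENNReal.ofReal (u t ω - v t ω) :=
    (measurable_ofReal_sub hu hv).comp measurable_prodMk_right
  simp only [Pi.zero_apply]
  rw [lintegral_eq_zero_iff h1]
  refine eventually_congr (Eventually.of_forall fun t => ?_)
  simp [ENNReal.ofReal_eq_zero]

lemma IsK.measurable_lintegral_sub (hK : IsK F K) (hu : IsProgressive F u)
    (hv : IsProgressive F v) :
    Measurable fun ω => ∫⁻ t, ENNReal.ofReal (u t ω - v t ω) ∂(pathMeasure K ω) :=
  hK.measurable_lintegral (measurable_ofReal_sub hu hv)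

lemma measurable_lintegral_lebesgue_sub (hu : IsProgressive F u) (hv : IsProgressive F v) :
    Measurable fun ω => ∫⁻ t, ENNReal.ofReal (u t ω - v t ω) ∂(lebesgue T) := by
  have hfin : IsFiniteMeasure (lebesgue T) := by
    refine ⟨?_⟩
    rw [lebesgue, (MeasurableEmbedding.subtype_coe measurableSet_Icc).comap_apply, image_univ,
      Subtype.range_coe]
    exact measure_Icc_lt_top
  exact measurable_lintegral_of_measurable_Iic (μ := fun _ => lebesgue T) (fun _ => hfin)
    (fun _ => measurable_const) (measurable_ofReal_sub hu hv)

/-- For jointly measurable processes, `E ∫ (u - v)⁺ dK = 0` means that almost surely `u ≤ v` holds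
`dK`-almost everywhere. -/
lemma IsK.lintegral_sub_eq_zero_iff (hK : IsK F K) (P : Measure Ω) (hu : IsProgressive F u)
    (hv : IsProgressive F v) :
    ∫⁻ ω, ∫⁻ t, ENNReal.ofReal (u t ω - v t ω) ∂(pathMeasure K ω) ∂P = 0 ↔
      ∀ᵐ ω ∂P, ∀ᵐ t ∂(pathMeasure K ω), u t ω ≤ v t ω :=
  lintegral_lintegral_sub_eq_zero_iff hu hv (hK.measurable_lintegral_sub hu hv)

lemma lintegral_lebesgue_sub_eq_zero_iff (P : Measure Ω) (hu : IsProgressive F u)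
    (hv : IsProgressive F v) :
    ∫⁻ ω, ∫⁻ t, ENNReal.ofReal (u t ω - v t ω) ∂(lebesgue T) ∂P = 0 ↔
      ∀ᵐ ω ∂P, ∀ᵐ t ∂(lebesgue T), u t ω ≤ v t ω :=
  lintegral_lintegral_sub_eq_zero_iff hu hv (measurable_lintegral_lebesgue_sub hu hv)

end Progressive

/-! ### Continuous versions of bounded martingales -/

/-- `N` is a continuous version, with values in `[0, 1]`, of the martingale `E[ξ | F t]`. -/
structure IsContinuousVersion (P : Measure Ω) (F : Filtration (TimeInterval T) m) (ξ : Ω → ℝ)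
    (N : TimeInterval T → Ω → ℝ) : Prop where
  continuous : ∀ ω, Continuous fun t => N t ω
  adapted : StronglyAdapted F N
  nonneg : ∀ t ω, 0 ≤ N t ω
  le_one : ∀ t ω, N t ω ≤ 1
  setIntegral_eq : ∀ t A, MeasurableSet[F t] A → ∫ ω in A, N t ω ∂P = ∫ ω in A, ξ ω ∂P

/-! ### Maximal inequalities along countably many times -/

section Maximal

variable {P : Measure Ω} [IsProbabilityMeasure P] {F : Filtration (TimeInterval T) m}
  {ξ : Ω → ℝ} {M : TimeInterval T → Ω → ℝ}

/-- Maximal inequality for finitely many times. -/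
lemma setIntegral_biUnion_le (hξ : Integrable ξ P) (hM : ∀ t, Integrable (M t) P)
    (heq : ∀ t A, MeasurableSet[F t] A → ∫ ω in A, M t ω ∂P = ∫ ω in A, ξ ω ∂P)
    {S : TimeInterval T → Set Ω} (hS : ∀ t, MeasurableSet[F t] (S t)) {c : ℝ}
    (hc : ∀ t, ∀ ω ∈ S t, M t ω ≤ c) (s : Finset (TimeInterval T)) :
    ∫ ω in ⋃ t ∈ s, S t, ξ ω ∂P ≤ c * P.real (⋃ t ∈ s, S t) := by
  induction s using Finset.induction_on_max with
  | empty => simp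
  | insert a s ha ih =>
    have hU : MeasurableSet[F a] (⋃ t ∈ s, S t) :=
      Finset.measurableSet_biUnion s fun t ht => F.mono (ha t ht).le _ (hS t)
    -- Since `a` is the latest time, the part of `S a` not met earlier belongs to `F a`; there `ξ`
    -- can be replaced by `M a`, which is at most `c`.
    have hD : MeasurableSet[F a] (S a \ ⋃ t ∈ s, S t) := (hS a).diff hU
    have hU' := F.le a _ hU
    have hD' := F.le a _ hD
    have hdisj : Disjoint (⋃ t ∈ s, S t) (S a \ ⋃ t ∈ s, S t) := disjoint_sdiff_self_right
    have hun : ⋃ t ∈ insert a s, S t = (⋃ t ∈ s, S t) ∪ (S a \ ⋃ t ∈ s, S t) := by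
      rw [Finset.set_biUnion_insert, union_sdiff_self, union_comm]
    rw [hun, setIntegral_union hdisj hD' hξ.integrableOn hξ.integrableOn,
      measureReal_union hdisj hD' (measure_ne_top _ _) (measure_ne_top _ _), mul_add]
    refine add_le_add ih ?_
    rw [← heq a _ hD]
    calc ∫ ω in S a \ ⋃ t ∈ s, S t, M a ω ∂P
        ≤ ∫ ω in S a \ ⋃ t ∈ s, S t, c ∂P :=
          setIntegral_mono_on (hM a).integrableOn (integrable_const c).integrableOn hD'
            fun ω hω => hc a ω hω.1
      _ = c * P.real (S a \ ⋃ t ∈ s, S t) := by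
          rw [setIntegral_const, smul_eq_mul, mul_comm]

/-- Maximal inequality for countably many times. -/
lemma setIntegral_iUnion_le (hξ : Integrable ξ P) (hM : ∀ t, Integrable (M t) P)
    (heq : ∀ t A, MeasurableSet[F t] A → ∫ ω in A, M t ω ∂P = ∫ ω in A, ξ ω ∂P)
    {S : TimeInterval T → Set Ω} (hS : ∀ t, MeasurableSet[F t] (S t)) {c : ℝ}
    (hc : ∀ t, ∀ ω ∈ S t, M t ω ≤ c) (u : ℕ → TimeInterval T) :
    ∫ ω in ⋃ k, S (u k), ξ ω ∂P ≤ c * P.real (⋃ k, S (u k)) := by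
  classical
  let V : ℕ → Set Ω := fun n => ⋃ t ∈ (Finset.range n).image u, S t
  have hV : ⋃ n, V n = ⋃ k, S (u k) := by
    ext ω
    simp only [V, mem_iUnion, Finset.mem_image, Finset.mem_range]
    constructor
    · rintro ⟨n, t, ⟨k, _, rfl⟩, h⟩
      exact ⟨k, h⟩
    · rintro ⟨k, h⟩
      exact ⟨k + 1, u k, ⟨k, Nat.lt_succ_self k, rfl⟩, h⟩
  have hmono : Monotone V := by
    intro a b hab
    refine biUnion_subset_biUnion_left fun t ht => ?_
    obtain ⟨k, hk, rfl⟩ := Finset.mem_image.1 (show t ∈ (Finset.range a).image u from ht)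
    exact Finset.mem_image.2
      ⟨k, Finset.mem_range.2 ((Finset.mem_range.1 hk).trans_le hab), rfl⟩
  have hmeas : ∀ n, MeasurableSet (V n) := fun n =>
    Finset.measurableSet_biUnion _ fun t _ => F.le t _ (hS t)
  have h1 := tendsto_setIntegral_of_monotone hmeas hmono (hξ.integrableOn (s := ⋃ n, V n))
  have h2 : Tendsto (fun n => c * P.real (V n)) atTop (𝓝 (c * P.real (⋃ n, V n))) :=
    ((ENNReal.tendsto_toReal (measure_ne_top _ _)).comp
      (tendsto_measure_iUnion_atTop hmono)).const_mul c
  rw [hV] at h1 h2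
  exact le_of_tendsto_of_tendsto' h1 h2 fun n => setIntegral_biUnion_le hξ hM heq hS hc _

end Maximal

lemma exists_timeSeq_of_isOpen {s : Set (TimeInterval T)} (hs : IsOpen s) (hne : s.Nonempty) :
    ∃ k, timeSeq T k ∈ s := by
  obtain ⟨_, hy, k, rfl⟩ :=
    (TopologicalSpace.denseRange_denseSeq (TimeInterval T)).inter_open_nonempty s hs hne
  exact ⟨k, hy⟩

/-! ### Continuous versions: closure properties and zeros -/

section Version

variable {P : Measure Ω} [IsProbabilityMeasure P] {F : Filtration (TimeInterval T) m}
  {ξ η : Ω → ℝ} {N N' : TimeInterval T → Ω → ℝ}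

lemma IsContinuousVersion.integrable (h : IsContinuousVersion P F ξ N) (t : TimeInterval T) :
    Integrable (N t) P := by
  refine Integrable.of_bound (C := 1) (((h.adapted t).mono (F.le t)).aestronglyMeasurable)
    (Eventually.of_forall fun ω => ?_)
  rw [Real.norm_eq_abs, abs_of_nonneg (h.nonneg t ω)]
  exact h.le_one t ω

lemma IsContinuousVersion.congr_ae (h : IsContinuousVersion P F ξ N) (hξη : ξ =ᵐ[P] η) :
    IsContinuousVersion P F η N where
  continuous := h.continuous
  adapted := h.adapted
  nonneg := h.nonneg
  le_one := h.le_one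
  setIntegral_eq t A hA :=
    (h.setIntegral_eq t A hA).trans (integral_congr_ae (ae_restrict_of_ae hξη))

lemma IsContinuousVersion.one_sub (h : IsContinuousVersion P F ξ N) (hξ : Integrable ξ P) :
    IsContinuousVersion P F (fun ω => 1 - ξ ω) fun t ω => 1 - N t ω where
  continuous ω := continuous_const.sub (h.continuous ω)
  adapted t := stronglyMeasurable_const.sub (h.adapted t)
  nonneg t ω := sub_nonneg.2 (h.le_one t ω)
  le_one t ω := sub_le_self _ (h.nonneg t ω)
  setIntegral_eq t A hA := by
    rw [integral_sub (integrable_const _).integrableOn (h.integrable t).integrableOn,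
      integral_sub (integrable_const _).integrableOn hξ.integrableOn, h.setIntegral_eq t A hA]

/-- Doob's inequality in the form needed for limits. -/
lemma IsContinuousVersion.measure_exists_lt_abs_sub_le (h : IsContinuousVersion P F ξ N)
    (h' : IsContinuousVersion P F η N') (hξ : Integrable ξ P) (hη : Integrable η P) {ε : ℝ}
    (hε : 0 < ε) :
    P {ω | ∃ t, ε < |N t ω - N' t ω|} ≤
      ENNReal.ofReal (2 * ((∫ ω, |ξ ω - η ω| ∂P) / ε)) := by
  have key : ∀ {ξ₁ ξ₂ : Ω → ℝ} {N₁ N₂ : TimeInterval T → Ω → ℝ},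
      IsContinuousVersion P F ξ₁ N₁ → IsContinuousVersion P F ξ₂ N₂ → Integrable ξ₁ P →
      Integrable ξ₂ P → P {ω | ∃ t, ε < N₁ t ω - N₂ t ω} ≤
        ENNReal.ofReal ((∫ ω, |ξ₁ ω - ξ₂ ω| ∂P) / ε) := by
    intro ξ₁ ξ₂ N₁ N₂ h₁ h₂ hi₁ hi₂
    let S : TimeInterval T → Set Ω := fun t => {ω | ε < N₁ t ω - N₂ t ω}
    have hS : ∀ t, MeasurableSet[F t] (S t) := fun t =>
      stronglyMeasurable_const.measurableSet_lt ((h₁.adapted t).sub (h₂.adapted t))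
    -- The difference is taken with the opposite sign because the maximal inequality concerns times
    -- at which the martingale is small.
    have hle := setIntegral_iUnion_le (M := fun t ω => N₂ t ω - N₁ t ω) (F := F)
      (ξ := fun ω => ξ₂ ω - ξ₁ ω) (hi₂.sub hi₁)
      (fun t => (h₂.integrable t).sub (h₁.integrable t))
      (fun t A hA => by
        rw [integral_sub (h₂.integrable t).integrableOn (h₁.integrable t).integrableOn,
          integral_sub hi₂.integrableOn hi₁.integrableOn, h₁.setIntegral_eq t A hA,
          h₂.setIntegral_eq t A hA])
      hS (c := -ε) (fun t ω hω => by
        have : ε < N₁ t ω - N₂ t ω := hω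
        linarith) (timeSeq T)
    have hsub : {ω | ∃ t, ε < N₁ t ω - N₂ t ω} ⊆ ⋃ k, S (timeSeq T k) := by
      rintro ω ⟨t, ht⟩
      obtain ⟨k, hk⟩ := exists_timeSeq_of_isOpen (s := {t | ε < N₁ t ω - N₂ t ω})
        (isOpen_lt continuous_const ((h₁.continuous ω).sub (h₂.continuous ω))) ⟨t, ht⟩
      exact mem_iUnion.2 ⟨k, hk⟩
    refine (measure_mono hsub).trans ?_
    rw [← ofReal_measureReal]
    refine ENNReal.ofReal_le_ofReal ?_
    rw [le_div_iff₀ hε]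
    have hint : Integrable (fun ω => |ξ₁ ω - ξ₂ ω|) P := (hi₁.sub hi₂).abs
    have h3 : -∫ ω in ⋃ k, S (timeSeq T k), (ξ₂ ω - ξ₁ ω) ∂P ≤ ∫ ω, |ξ₁ ω - ξ₂ ω| ∂P := by
      rw [← integral_neg]
      refine le_trans ?_ (setIntegral_le_integral (s := ⋃ k, S (timeSeq T k)) hint
        (Eventually.of_forall fun ω => abs_nonneg _))
      refine integral_mono (hi₂.sub hi₁).neg.integrableOn hint.integrableOn fun ω => ?_
      have := le_abs_self (ξ₁ ω - ξ₂ ω)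
      simp only
      linarith
    linarith
  have hsub : {ω | ∃ t, ε < |N t ω - N' t ω|} ⊆
      {ω | ∃ t, ε < N t ω - N' t ω} ∪ {ω | ∃ t, ε < N' t ω - N t ω} := by
    rintro ω ⟨t, ht⟩
    rcases lt_abs.1 ht with h1 | h1
    · exact Or.inl ⟨t, h1⟩
    · exact Or.inr ⟨t, by rwa [neg_sub] at h1⟩
  refine (measure_mono hsub).trans ((measure_union_le _ _).trans ?_)
  have hnn : 0 ≤ (∫ ω, |ξ ω - η ω| ∂P) / ε :=
    div_nonneg (integral_nonneg fun ω => abs_nonneg _) hε.le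
  rw [two_mul, ENNReal.ofReal_add hnn hnn]
  refine add_le_add (key h h' hξ hη) ((key h' h hη hξ).trans (le_of_eq ?_))
  simp only [abs_sub_comm]

/-- The class of variables with a continuous version is closed under dominated limits. -/
lemma exists_isContinuousVersion_of_tendsto (hF : ∀ (t : TimeInterval T) (A : Set Ω), P A = 0 → MeasurableSet[F t] A)
    {x : ℕ → Ω → ℝ} (hx : ∀ n, ∃ N, IsContinuousVersion P F (x n) N)
    (hmeas : ∀ n, AEStronglyMeasurable (x n) P) (hbd : ∀ n ω, ‖x n ω‖ ≤ 1)
    (hlim : ∀ᵐ ω ∂P, Tendsto (fun n => x n ω) atTop (𝓝 (ξ ω))) :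
    ∃ N, IsContinuousVersion P F ξ N := by
  have hint : ∀ n, Integrable (x n) P := fun n =>
    Integrable.of_bound (hmeas n) 1 (Eventually.of_forall (hbd n))
  have hξm : AEStronglyMeasurable ξ P := aestronglyMeasurable_of_tendsto_ae _ hmeas hlim
  have hξb : ∀ᵐ ω ∂P, ‖ξ ω‖ ≤ 1 := by
    filter_upwards [hlim] with ω hω
    exact le_of_tendsto hω.norm (Eventually.of_forall fun n => hbd n ω)
  have hξi : Integrable ξ P := Integrable.of_bound hξm 1 hξb
  have hL1 : Tendsto (fun n => ∫ ω, |x n ω - ξ ω| ∂P) atTop (𝓝 0) := by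
    have := tendsto_integral_of_dominated_convergence (μ := P) (F := fun n ω => |x n ω - ξ ω|)
      (f := fun _ => (0 : ℝ)) (fun _ => (2 : ℝ))
      (fun n => ((hmeas n).sub hξm).norm) (integrable_const _) (fun n => ?_) ?_
    · simpa using this
    · filter_upwards [hξb] with ω hω
      rw [Real.norm_eq_abs, abs_abs]
      have h1 := abs_sub (x n ω) (ξ ω)
      have h2 := hbd n ω
      rw [Real.norm_eq_abs] at h2 hω
      linarith
    · filter_upwards [hlim] with ω hω
      simpa using (hω.sub_const (ξ ω)).abs
  -- Consecutive terms of the subsequence are within `4⁻ⁿ` in `L¹`; against the threshold `2⁻ⁿ`, the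
  -- maximal inequality leaves the summable bound `2 · 2⁻ⁿ`, so Borel–Cantelli gives uniform
  -- convergence of the paths.
  obtain ⟨φ, hφ, hφ'⟩ := extraction_forall_of_eventually
    (P := fun n k => ∫ ω, |x k ω - ξ ω| ∂P < (1 / 4 : ℝ) ^ n / 2)
    (fun n => (hL1.eventually_lt_const (by positivity)))
  choose N hN using fun n => hx (φ n)
  have hstep : ∀ n, ∫ ω, |x (φ n) ω - x (φ (n + 1)) ω| ∂P ≤ (1 / 4 : ℝ) ^ n := by
    intro n
    have h1 := hφ' n
    have h2 := hφ' (n + 1)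
    have h3 : (1 / 4 : ℝ) ^ (n + 1) ≤ (1 / 4 : ℝ) ^ n :=
      pow_le_pow_of_le_one (by norm_num) (by norm_num) (Nat.le_succ n)
    have h4 : ∫ ω, |x (φ n) ω - x (φ (n + 1)) ω| ∂P ≤
        ∫ ω, (|x (φ n) ω - ξ ω| + |x (φ (n + 1)) ω - ξ ω|) ∂P := by
      refine integral_mono ((hint _).sub (hint _)).abs
        (((hint _).sub hξi).abs.add ((hint _).sub hξi).abs) fun ω => ?_
      have := abs_sub_le (x (φ n) ω) (ξ ω) (x (φ (n + 1)) ω)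
      rwa [abs_sub_comm (ξ ω)] at this
    have h5 : ∫ ω, (|x (φ n) ω - ξ ω| + |x (φ (n + 1)) ω - ξ ω|) ∂P =
        ∫ ω, |x (φ n) ω - ξ ω| ∂P + ∫ ω, |x (φ (n + 1)) ω - ξ ω| ∂P :=
      integral_add ((hint _).sub hξi).abs ((hint _).sub hξi).abs
    linarith
  let f : ℕ → Ω → C(TimeInterval T, ℝ) := fun n ω => ⟨fun t => N n t ω, (hN n).continuous ω⟩
  have hBC : ∀ᵐ ω ∂P, ∀ᶠ n in atTop, ω ∉ {ω | ∃ t, (1 / 2 : ℝ) ^ n < |N n t ω - N (n + 1) t ω|} := by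
    refine ae_eventually_notMem ?_
    have hle : ∀ n, P {ω | ∃ t, (1 / 2 : ℝ) ^ n < |N n t ω - N (n + 1) t ω|} ≤
        ENNReal.ofReal (2 * (1 / 2 : ℝ) ^ n) := by
      intro n
      refine ((hN n).measure_exists_lt_abs_sub_le (hN (n + 1)) (hint _) (hint _)
        (by positivity)).trans (ENNReal.ofReal_le_ofReal ?_)
      refine mul_le_mul_of_nonneg_left ?_ (by norm_num)
      rw [div_le_iff₀ (by positivity), ← mul_pow]
      refine (hstep n).trans (le_of_eq ?_)
      norm_num
    refine ne_top_of_le_ne_top ?_ (ENNReal.tsum_le_tsum hle)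
    have hs : Summable fun n : ℕ => 2 * (1 / 2 : ℝ) ^ n := summable_geometric_two.mul_left 2
    rw [← ENNReal.ofReal_tsum_of_nonneg (fun n => by positivity) hs]
    exact ENNReal.ofReal_ne_top
  have hconv : ∀ᵐ ω ∂P, ∃ g, Tendsto (fun n => f n ω) atTop (𝓝 g) := by
    filter_upwards [hBC] with ω hω
    obtain ⟨n₀, hn₀⟩ := eventually_atTop.1 hω
    have hcau : CauchySeq fun n => f (n + n₀) ω := by
      refine cauchySeq_of_le_geometric (1 / 2 : ℝ) 1 (by norm_num) fun n => ?_
      rw [ContinuousMap.dist_le (by positivity)]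
      intro t
      have h1 := hn₀ (n + n₀) (Nat.le_add_left _ _)
      simp only [not_exists, not_lt] at h1
      have h2 := h1 t
      rw [Real.dist_eq, one_mul, show n + 1 + n₀ = n + n₀ + 1 by ring]
      refine h2.trans (pow_le_pow_of_le_one (by norm_num) (by norm_num) (Nat.le_add_right _ _))
    obtain ⟨g, hg⟩ := cauchySeq_tendsto_of_complete hcau
    exact ⟨g, (tendsto_add_atTop_iff_nat n₀).1 hg⟩
  classical
  let G : Set Ω := {ω | ∃ g, Tendsto (fun n => f n ω) atTop (𝓝 g)}
  have hGc : P Gᶜ = 0 := hconv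
  -- Every `F t` contains the null sets, so replacing the limit by `0` off `G` keeps it adapted
  -- while making every path continuous.
  have hG : ∀ t, MeasurableSet[F t] G := fun t => (hF t _ hGc).of_compl
  let g : Ω → C(TimeInterval T, ℝ) := fun ω => if h : ω ∈ G then h.choose else 0
  have hg : ∀ ω ∈ G, Tendsto (fun n => f n ω) atTop (𝓝 (g ω)) := by
    intro ω hω
    simp only [g, dif_pos hω]
    exact hω.choose_spec
  have hgt : ∀ t ω, Tendsto (fun n => G.indicator (N n t) ω) atTop (𝓝 (g ω t)) := by
    intro t ω
    by_cases hω : ω ∈ G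
    · simp only [indicator_of_mem hω]
      exact ((continuous_eval_const t).tendsto _).comp (hg ω hω)
    · simp only [indicator_of_notMem hω, g, dif_neg hω, ContinuousMap.zero_apply]
      exact tendsto_const_nhds
  have hind : ∀ n t ω, G.indicator (N n t) ω ∈ Icc (0 : ℝ) 1 := by
    intro n t ω
    by_cases hω : ω ∈ G
    · rw [indicator_of_mem hω]
      exact ⟨(hN n).nonneg t ω, (hN n).le_one t ω⟩
    · rw [indicator_of_notMem hω]
      exact ⟨le_rfl, zero_le_one⟩
  refine ⟨fun t ω => g ω t, fun ω => (g ω).continuous, fun t => ?_, fun t ω => ?_, fun t ω => ?_,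
    fun t A hA => ?_⟩
  · exact stronglyMeasurable_of_tendsto atTop
      (fun n => ((hN n).adapted t).indicator (hG t)) (tendsto_pi_nhds.2 (hgt t))
  · exact ge_of_tendsto' (hgt t ω) fun n => (hind n t ω).1
  · exact le_of_tendsto' (hgt t ω) fun n => (hind n t ω).2
  · have h1 : Tendsto (fun n => ∫ ω in A, N n t ω ∂P) atTop (𝓝 (∫ ω in A, g ω t ∂P)) := by
      refine tendsto_integral_of_dominated_convergence (fun _ => (1 : ℝ))
        (fun n => (((hN n).integrable t).aestronglyMeasurable).restrict)
        (integrable_const _) (fun n => Eventually.of_forall fun ω => ?_) (ae_restrict_of_ae ?_)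
      · rw [Real.norm_eq_abs, abs_of_nonneg ((hN n).nonneg t ω)]
        exact (hN n).le_one t ω
      · filter_upwards [hconv] with ω hω
        exact ((continuous_eval_const t).tendsto _).comp (hg ω hω)
    have h2 : Tendsto (fun n => ∫ ω in A, x (φ n) ω ∂P) atTop (𝓝 (∫ ω in A, ξ ω ∂P)) := by
      refine tendsto_integral_of_dominated_convergence (fun _ => (1 : ℝ))
        (fun n => (hmeas (φ n)).restrict) (integrable_const _)
        (fun n => Eventually.of_forall fun ω => hbd _ ω) (ae_restrict_of_ae ?_)
      filter_upwards [hlim] with ω hω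
      exact hω.comp hφ.tendsto_atTop
    refine tendsto_nhds_unique h1 (h2.congr fun n => ?_)
    exact ((hN n).setIntegral_eq t A hA).symm

/-- A function measurable for a sub-`σ`-algebra whose integrals over its sets are at most those of `c` is at most `c`. -/
lemma ae_le_const_of_setIntegral_le {m' : MeasurableSpace Ω} (hm : m' ≤ m) {f : Ω → ℝ} {c : ℝ}
    (hfm : StronglyMeasurable[m'] f) (hfi : Integrable f P)
    (hle : ∀ A, MeasurableSet[m'] A → ∫ ω in A, f ω ∂P ≤ c * P.real A) : ∀ᵐ ω ∂P, f ω ≤ c := by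
  have hA : MeasurableSet[m'] {ω | c < f ω} :=
    stronglyMeasurable_const.measurableSet_lt hfm
  have hA' := hm _ hA
  have h1 : ∫ ω in {ω | c < f ω}, (f ω - c) ∂P = 0 := by
    refine le_antisymm ?_ (setIntegral_nonneg hA' fun ω hω => sub_nonneg.2 (le_of_lt hω))
    rw [integral_sub hfi.integrableOn (integrable_const _).integrableOn, setIntegral_const,
      smul_eq_mul, mul_comm]
    linarith [hle _ hA]
  have h2 := (setIntegral_eq_zero_iff_of_nonneg_ae ((ae_restrict_iff' hA').2
    (Eventually.of_forall fun ω hω => sub_nonneg.2 (le_of_lt hω)))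
    (hfi.sub (integrable_const c)).integrableOn).1 h1
  filter_upwards [(ae_restrict_iff' hA').1 h2] with ω hω
  by_contra hcon
  push Not at hcon
  have := hω hcon
  simp only [Pi.zero_apply] at this
  linarith

/-- The sum of the versions is at most `1` only almost surely; truncating it gives the bound
everywhere without changing the integrals. -/
lemma IsContinuousVersion.add (h : IsContinuousVersion P F ξ N) (h' : IsContinuousVersion P F η N')
    (hξ : Integrable ξ P) (hη : Integrable η P) (hle : ∀ ω, ξ ω + η ω ≤ 1) :
    IsContinuousVersion P F (fun ω => ξ ω + η ω) fun t ω => min (N t ω + N' t ω) 1 where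
  continuous ω := ((h.continuous ω).add (h'.continuous ω)).min continuous_const
  adapted t := (continuous_id.min continuous_const).comp_stronglyMeasurable
    ((h.adapted t).add (h'.adapted t))
  nonneg t ω := le_min (add_nonneg (h.nonneg t ω) (h'.nonneg t ω)) zero_le_one
  le_one t ω := min_le_right _ _
  setIntegral_eq t A hA := by
    have hadd : ∀ A, MeasurableSet[F t] A →
        ∫ ω in A, (N t ω + N' t ω) ∂P = ∫ ω in A, (ξ ω + η ω) ∂P := fun A hA => by
      rw [integral_add (h.integrable t).integrableOn (h'.integrable t).integrableOn,
        integral_add hξ.integrableOn hη.integrableOn, h.setIntegral_eq t A hA,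
        h'.setIntegral_eq t A hA]
    have hae : ∀ᵐ ω ∂P, N t ω + N' t ω ≤ 1 := by
      refine ae_le_const_of_setIntegral_le (F.le t) ((h.adapted t).add (h'.adapted t))
        ((h.integrable t).add (h'.integrable t)) fun A hA => ?_
      rw [hadd A hA]
      calc ∫ ω in A, (ξ ω + η ω) ∂P ≤ ∫ ω in A, (1 : ℝ) ∂P :=
            integral_mono (hξ.add hη).integrableOn (integrable_const _).integrableOn hle
        _ = 1 * P.real A := by rw [setIntegral_const, smul_eq_mul, mul_comm]
    rw [← hadd A hA]
    refine integral_congr_ae (ae_restrict_of_ae ?_)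
    filter_upwards [hae] with ω hω
    exact min_eq_left hω

/-- Monotone class argument: continuous versions for a generating `π`-system suffice. -/
lemma exists_isContinuousVersion_of_generateFrom
    (hF : ∀ (t : TimeInterval T) (A : Set Ω), P A = 0 → MeasurableSet[F t] A) {X : Type*} [mX : MeasurableSpace X]
    {φ : Ω → X} (hφ : Measurable φ) {p : Set (Set X)} (hp : IsPiSystem p)
    (hgen : mX = MeasurableSpace.generateFrom p)
    (hbase : ∀ s ∈ p, ∃ N, IsContinuousVersion P F ((φ ⁻¹' s).indicator fun _ => 1) N)
    {s : Set X} (hs : MeasurableSet s) :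
    ∃ N, IsContinuousVersion P F ((φ ⁻¹' s).indicator fun _ => 1) N := by
  have hint : ∀ {A : Set Ω}, MeasurableSet A →
      Integrable (A.indicator fun _ => (1 : ℝ)) P := fun hA =>
    (integrable_const (1 : ℝ)).indicator hA
  induction s, hs using MeasurableSpace.induction_on_inter hgen hp with
  | empty =>
    refine ⟨fun _ _ => 0, fun _ => continuous_const, fun _ => stronglyMeasurable_const,
      fun _ _ => le_rfl, fun _ _ => zero_le_one, fun _ _ _ => ?_⟩
    simp
  | basic s hs => exact hbase s hs
  | compl s hs ih =>
    obtain ⟨N, hN⟩ := ih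
    refine ⟨_, (hN.one_sub (hint (hφ hs))).congr_ae (Eventually.of_forall fun ω => ?_)⟩
    by_cases hω : φ ω ∈ s
    · simp [indicator, hω]
    · simp [indicator, hω]
  | iUnion f hd hm ih =>
    -- Disjointness makes the indicator of a finite union a sum of indicators; the countable union
    -- is then a bounded limit.
    have hpart : ∀ n, ∃ N, IsContinuousVersion P F
        ((φ ⁻¹' (⋃ i ∈ Finset.range n, f i)).indicator fun _ => 1) N := by
      intro n
      induction n with
      | zero =>
        refine ⟨fun _ _ => 0, fun _ => continuous_const, fun _ => stronglyMeasurable_const,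
          fun _ _ => le_rfl, fun _ _ => zero_le_one, fun _ _ _ => ?_⟩
        simp
      | succ n ihn =>
        obtain ⟨N₁, h₁⟩ := ihn
        obtain ⟨N₂, h₂⟩ := ih n
        have hdis : ∀ ω, φ ω ∈ f n → φ ω ∉ ⋃ i ∈ Finset.range n, f i := by
          intro ω hω hcon
          simp only [mem_iUnion, Finset.mem_range] at hcon
          obtain ⟨i, hi, hi'⟩ := hcon
          exact disjoint_left.1 (hd (ne_of_lt hi)) hi' hω
        refine ⟨_, (h₁.add h₂ (hint (hφ (Finset.measurableSet_biUnion _ fun i _ => hm i)))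
          (hint (hφ (hm n))) fun ω => ?_).congr_ae (Eventually.of_forall fun ω => ?_)⟩
        · by_cases hω : φ ω ∈ f n
          · rw [indicator_of_notMem (show ω ∉ φ ⁻¹' ⋃ i ∈ Finset.range n, f i from hdis ω hω),
              zero_add]
            exact indicator_le_self' (fun _ _ => zero_le_one) ω
          · rw [indicator_of_notMem (s := φ ⁻¹' f n) hω, add_zero]
            exact indicator_le_self' (fun _ _ => zero_le_one) ω
        · rw [Finset.range_add_one, Finset.set_biUnion_insert, preimage_union, union_comm,
            indicator_union_of_disjoint]
          exact disjoint_right.2 hdis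
    refine exists_isContinuousVersion_of_tendsto hF hpart
      (fun n => (hint (hφ (Finset.measurableSet_biUnion _ fun i _ =>
        hm i))).aestronglyMeasurable) (fun n ω => ?_) (Eventually.of_forall fun ω => ?_)
    · refine (norm_indicator_le_norm_self _ _).trans ?_
      simp
    · by_cases hω : φ ω ∈ ⋃ i, f i
      · obtain ⟨i, hi⟩ := mem_iUnion.1 hω
        refine tendsto_const_nhds.congr' ?_
        filter_upwards [eventually_gt_atTop i] with n hn
        rw [indicator_of_mem (show ω ∈ φ ⁻¹' ⋃ i, f i from hω), indicator_of_mem]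
        exact mem_biUnion (Finset.mem_coe.2 (Finset.mem_range.2 hn)) hi
      · refine tendsto_const_nhds.congr fun n => ?_
        rw [indicator_of_notMem (show ω ∉ φ ⁻¹' ⋃ i, f i from hω), indicator_of_notMem]
        exact fun h => hω (iUnion₂_subset_iUnion _ _ h)

/-- A nonnegative continuous martingale with terminal value `1_A` does not vanish on `A`. -/
lemma IsContinuousVersion.ae_pos {A : Set Ω} (hA : MeasurableSet A)
    (h : IsContinuousVersion P F (A.indicator fun _ => 1) N) :
    ∀ᵐ ω ∂P, ω ∈ A → ∀ t, 0 < N t ω := by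
  have hint : Integrable (A.indicator fun _ => (1 : ℝ)) P := (integrable_const _).indicator hA
  have hle : ∀ ε : ℝ, 0 < ε → P.real (A ∩ {ω | ∃ t, N t ω ≤ 0}) ≤ ε := by
    intro ε hε
    let S : TimeInterval T → Set Ω := fun t => {ω | N t ω < ε}
    have hS : ∀ t, MeasurableSet[F t] (S t) := fun t =>
      (h.adapted t).measurableSet_lt stronglyMeasurable_const
    -- The part of `A` on which `N` goes below `ε` has probability at most `ε`. By continuity, a
    -- zero of `N` forces a value below `ε` at some dense time, for every `ε`.
    have h1 := setIntegral_iUnion_le hint h.integrable h.setIntegral_eq hS (c := ε)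
      (fun t ω hω => le_of_lt hω) (timeSeq T)
    have hSm : MeasurableSet (⋃ k, S (timeSeq T k)) :=
      MeasurableSet.iUnion fun k => F.le _ _ (hS _)
    rw [setIntegral_indicator hA, setIntegral_const, smul_eq_mul, mul_one] at h1
    have hsub : A ∩ {ω | ∃ t, N t ω ≤ 0} ⊆ (⋃ k, S (timeSeq T k)) ∩ A := by
      rintro ω ⟨hωA, t, ht⟩
      obtain ⟨k, hk⟩ := exists_timeSeq_of_isOpen (s := {t | N t ω < ε})
        (isOpen_lt (h.continuous ω) continuous_const) ⟨t, lt_of_le_of_lt ht hε⟩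
      exact ⟨mem_iUnion.2 ⟨k, hk⟩, hωA⟩
    refine (measureReal_mono hsub).trans (h1.trans ?_)
    exact mul_le_of_le_one_right hε.le measureReal_le_one
  have h0 : P.real (A ∩ {ω | ∃ t, N t ω ≤ 0}) = 0 :=
    le_antisymm (le_of_forall_pos_le_add fun ε hε => by rw [zero_add]; exact hle ε hε)
      measureReal_nonneg
  have h0' : P (A ∩ {ω | ∃ t, N t ω ≤ 0}) = 0 := (measureReal_eq_zero_iff).1 h0
  filter_upwards [measure_eq_zero_iff_ae_notMem.1 h0'] with ω hω hωA t
  by_contra hcon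
  exact hω ⟨hωA, t, not_lt.1 hcon⟩

/-- On an event of `F t` disjoint from `A`, the martingale with terminal value `1_A` vanishes at
time `t`. -/
lemma IsContinuousVersion.ae_eq_zero {A B : Set Ω}
    (h : IsContinuousVersion P F (A.indicator fun _ => 1) N) (t : TimeInterval T)
    (hB : MeasurableSet[F t] B) (hAB : Disjoint A B) : ∀ᵐ ω ∂P, ω ∈ B → N t ω = 0 := by
  have hB' := F.le t _ hB
  have h1 : ∫ ω in B, N t ω ∂P = 0 := by
    rw [h.setIntegral_eq t B hB]
    refine (setIntegral_congr_fun hB' fun ω hω => ?_).trans (integral_zero _ _)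
    exact indicator_of_notMem (disjoint_right.1 hAB hω) _
  have h2 := (setIntegral_eq_zero_iff_of_nonneg_ae
    (Eventually.of_forall fun ω => h.nonneg t ω) (h.integrable t).integrableOn).1 h1
  filter_upwards [(ae_restrict_iff' hB').1 h2] with ω hω hωB using hω hωB

end Version

/-! ### The augmented Brownian filtration -/

/-- Adding the null sets to a `σ`-algebra only adds sets which are almost everywhere equal to sets
of that `σ`-algebra. -/
lemma exists_measurableSet_ae_eq_of_sup_null {P : Measure Ω} {m' : MeasurableSpace Ω} {A : Set Ω}
    (hA : MeasurableSet[m' ⊔ MeasurableSpace.generateFrom {N : Set Ω | P N = 0}] A) :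
    ∃ A', MeasurableSet[m'] A' ∧ A =ᵐ[P] A' := by
  -- The sets almost everywhere equal to a set of `m'` form a `σ`-algebra containing both `m'` and
  -- the null sets.
  let m₁ : MeasurableSpace Ω :=
    { MeasurableSet' := fun A => ∃ A', MeasurableSet[m'] A' ∧ A =ᵐ[P] A'
      measurableSet_empty := ⟨∅, @MeasurableSet.empty _ m', EventuallyEq.rfl⟩
      measurableSet_compl := by
        rintro A ⟨A', hA', h⟩
        exact ⟨A'ᶜ, hA'.compl, h.compl⟩
      measurableSet_iUnion := by
        intro f hf
        choose g hg hfg using hf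
        exact ⟨⋃ i, g i, MeasurableSet.iUnion hg, Filter.EventuallyEq.countable_iUnion hfg⟩ }
  have hle : m' ⊔ MeasurableSpace.generateFrom {N : Set Ω | P N = 0} ≤ m₁ := by
    refine sup_le (fun B hB => ⟨B, hB, EventuallyEq.rfl⟩) (MeasurableSpace.generateFrom_le ?_)
    intro N hN
    exact ⟨∅, @MeasurableSet.empty _ m', ae_eq_empty.2 hN⟩
  exact hle A hA

section Independence

variable {P : Measure Ω} [IsProbabilityMeasure P]
  {B : TimeInterval T → Ω → EuclideanSpace ℝ (Fin d)}

/-- The increasing enumeration is frozen at its last value, which gives the monotone sequence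
required by `HasIndepIncrements.nat`. -/
lemma exists_monotone_range (S : Finset (TimeInterval T)) (hS : S.Nonempty) :
    ∃ u : ℕ → TimeInterval T, Monotone u ∧ ∀ s ∈ S, ∃ i, u i = s := by
  have hn : 0 < S.card := Finset.card_pos.2 hS
  refine ⟨fun i => S.orderEmbOfFin rfl ⟨min i (S.card - 1), by omega⟩, ?_, ?_⟩
  · intro i j hij
    refine (S.orderEmbOfFin rfl).monotone ?_
    exact min_le_min_right _ hij
  · intro s hs
    have : s ∈ Set.range (S.orderEmbOfFin rfl) := by
      rw [Finset.range_orderEmbOfFin]; exact hs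
    obtain ⟨i, rfl⟩ := this
    refine ⟨i, ?_⟩
    exact congrArg (S.orderEmbOfFin rfl) (Fin.ext (min_eq_left (Nat.le_sub_one_of_lt i.2)))

/-- A process with independent increments: the past is independent of the future increments. -/
lemma indepFun_past_future (hm : ∀ t, Measurable (B t)) (hz : ∀ᵐ ω ∂P, B ⊥ ω = 0)
    (hB : HasIndepIncrements B P) (t : TimeInterval T) :
    IndepFun (fun ω (j : Iic t) => B j ω)
      (fun ω (s : TimeInterval T) => B s ω - B (min s t) ω) P := by
  refine IndepFun.process_indepFun_process (fun j => hm j) (fun s => (hm s).sub (hm _))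
    fun I J => ?_
  classical
  obtain ⟨u, hu, huS⟩ := exists_monotone_range
    (insert ⊥ (insert t (I.image (fun j : Iic t => (j : TimeInterval T)) ∪ J)))
    (Finset.insert_nonempty _ _)
  obtain ⟨i₀, hi₀⟩ := huS ⊥ (by simp)
  obtain ⟨k, hk⟩ := huS t (by simp)
  have hu0 : u 0 = ⊥ := le_bot_iff.1 (hi₀ ▸ hu (Nat.zero_le _))
  let D : ℕ → Ω → EuclideanSpace ℝ (Fin d) := fun i ω => B (u (i + 1)) ω - B (u i) ω
  have hDm : ∀ i, Measurable (D i) := fun i => (hm _).sub (hm _)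
  have hind : iIndep (fun i => MeasurableSpace.comap (D i) inferInstance) P :=
    (iIndepFun_iff_iIndep ..).1 (hB.nat hu)
  -- As `u k = t`, increments of index below `k` carry the past and those of index at least `k` the
  -- future.
  have hsup := indep_iSup_of_disjoint (fun i => (hDm i).comap_le) hind
    (S := Iio k) (T := Ici k) (Iio_disjoint_Ici le_rfl)
  have hpast : ∀ j : I, Measurable[⨆ i ∈ Iio k, MeasurableSpace.comap (D i) inferInstance]
      fun ω => B (j : Iic t) ω - B ⊥ ω := by
    intro j
    obtain ⟨i, hi⟩ := huS ((j : Iic t) : TimeInterval T) (by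
      refine Finset.mem_insert_of_mem (Finset.mem_insert_of_mem (Finset.mem_union_left _ ?_))
      exact Finset.mem_image_of_mem _ j.2)
    -- A past time listed after index `k` must equal `t`, since `u` is monotone; index `k` then
    -- serves as well.
    obtain ⟨i', hi'k, hi'⟩ : ∃ i' ≤ k, u i' = ((j : Iic t) : TimeInterval T) := by
      rcases le_total i k with h | h
      · exact ⟨i, h, hi⟩
      · refine ⟨k, le_rfl, le_antisymm ((hu h).trans hi.le) ?_⟩
        rw [hk]
        exact (j : Iic t).2
    have hsum : (fun ω => B (j : Iic t) ω - B ⊥ ω) = fun ω => ∑ l ∈ Finset.range i', D l ω := by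
      funext ω
      rw [Finset.sum_range_sub (fun l => B (u l) ω), hu0, hi']
    rw [hsum]
    refine Finset.measurable_fun_sum _ fun l hl => ?_
    refine (comap_measurable (D l)).mono ?_ le_rfl
    exact le_iSup₂_of_le (f := fun i (_ : i ∈ Iio k) =>
      MeasurableSpace.comap (D i) inferInstance) l ((Finset.mem_range.1 hl).trans_le hi'k) le_rfl
  have hfut : ∀ s : J, Measurable[⨆ i ∈ Ici k, MeasurableSpace.comap (D i) inferInstance]
      fun ω => B s ω - B (min (s : TimeInterval T) t) ω := by
    intro s
    rcases le_total (s : TimeInterval T) t with hst | hst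
    · simp only [min_eq_left hst, sub_self]
      exact measurable_const
    · obtain ⟨i, hi⟩ := huS (s : TimeInterval T) (by
        refine Finset.mem_insert_of_mem (Finset.mem_insert_of_mem (Finset.mem_union_right _ s.2)))
      obtain ⟨i', hi'k, hi'⟩ : ∃ i' ≥ k, u i' = (s : TimeInterval T) := by
        rcases le_total k i with h | h
        · exact ⟨i, h, hi⟩
        · refine ⟨k, le_rfl, le_antisymm ?_ (hi.symm.le.trans (hu h))⟩
          rw [hk]
          exact hst
      have hsum : (fun ω => B s ω - B (min (s : TimeInterval T) t) ω) =
          fun ω => ∑ l ∈ Finset.Ico k i', D l ω := by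
        funext ω
        rw [Finset.sum_Ico_eq_sub _ hi'k, Finset.sum_range_sub (fun l => B (u l) ω),
          Finset.sum_range_sub (fun l => B (u l) ω), min_eq_right hst, hk, hi']
        abel
      rw [hsum]
      refine Finset.measurable_fun_sum _ fun l hl => ?_
      refine (comap_measurable (D l)).mono ?_ le_rfl
      exact le_iSup₂_of_le (f := fun i (_ : i ∈ Ici k) =>
        MeasurableSpace.comap (D i) inferInstance) l (Finset.mem_Ico.1 hl).1 le_rfl
  have hI : IndepFun (fun ω (j : I) => B (j : Iic t) ω - B ⊥ ω)
      (fun ω (s : J) => B s ω - B (min (s : TimeInterval T) t) ω) P :=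
    (IndepFun_iff_Indep ..).2 (indep_of_indep_of_le hsup
      (measurable_iff_comap_le.1 (@measurable_pi_lambda _ _ _ (_) _ _ hpast))
      (measurable_iff_comap_le.1 (@measurable_pi_lambda _ _ _ (_) _ _ hfut)))
  refine hI.congr ?_ EventuallyEq.rfl
  filter_upwards [hz] with ω hω
  funext j
  rw [hω, sub_zero]

variable [P.IsComplete]

lemma augmentedFiltration_apply (hm : ∀ t, Measurable (B t)) (t : TimeInterval T) :
    augmentedFiltration P B hm t =
      MeasurableSpace.comap (fun ω (j : Iic t) => B j ω) inferInstance ⊔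
        MeasurableSpace.generateFrom {N : Set Ω | P N = 0} := by
  rw [← Filtration.natural_eq_comap B fun t => (hm t).stronglyMeasurable]
  rfl

lemma measurableSet_augmentedFiltration_of_null (hm : ∀ t, Measurable (B t)) (t : TimeInterval T)
    (A : Set Ω) (hA : P A = 0) : MeasurableSet[augmentedFiltration P B hm t] A := by
  rw [augmentedFiltration_apply]
  exact le_sup_right (a := MeasurableSpace.comap (fun ω (j : Iic t) => B j ω) inferInstance) A
    (MeasurableSpace.measurableSet_generateFrom hA)

lemma measurable_augmentedFiltration (hm : ∀ t, Measurable (B t)) {s t : TimeInterval T}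
    (hst : s ≤ t) : Measurable[augmentedFiltration P B hm t] (B s) := by
  rw [augmentedFiltration_apply]
  have h1 : Measurable[MeasurableSpace.comap (fun ω (j : Iic t) => B j ω) inferInstance] (B s) :=
    (measurable_pi_apply (⟨s, hst⟩ : Iic t)).comp
      (comap_measurable fun ω (j : Iic t) => B j ω)
  exact h1.mono le_sup_left le_rfl

/-- Future increments are independent of the augmented past. -/
lemma indep_augmentedFiltration (hm : ∀ t, Measurable (B t)) (hz : ∀ᵐ ω ∂P, B ⊥ ω = 0)
    (hB : HasIndepIncrements B P) (t : TimeInterval T) :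
    Indep (augmentedFiltration P B hm t)
      (MeasurableSpace.comap (fun ω (s : TimeInterval T) => B s ω - B (min s t) ω)
        inferInstance) P := by
  have h := (Indep_iff _ _ _).1 ((IndepFun_iff_Indep ..).1 (indepFun_past_future hm hz hB t))
  rw [Indep_iff]
  intro A C hA hC
  rw [augmentedFiltration_apply] at hA
  obtain ⟨A', hA', hAA'⟩ := exists_measurableSet_ae_eq_of_sup_null hA
  rw [measure_congr (hAA'.inter (ae_eq_refl C)), measure_congr hAA']
  exact h A' C hA' hC

/-- Freezing lemma. -/
lemma setIntegral_add_eq_of_indep {ι : Type*} [Fintype ι] {F : Filtration (TimeInterval T) m} {t : TimeInterval T}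
    {X Y : Ω → ι → EuclideanSpace ℝ (Fin d)} (hX : Measurable[F t] X) (hY : Measurable Y)
    (hind : Indep (F t) (MeasurableSpace.comap Y inferInstance) P)
    {f : (ι → EuclideanSpace ℝ (Fin d)) → ℝ} (hf : Measurable f) {C : ℝ} (hC : ∀ x, ‖f x‖ ≤ C)
    {A : Set Ω} (hA : MeasurableSet[F t] A) :
    ∫ ω in A, (∫ ω', f (X ω + Y ω') ∂P) ∂P = ∫ ω in A, f (X ω + Y ω) ∂P := by
  let Z : Ω → ℝ × (ι → EuclideanSpace ℝ (Fin d)) := fun ω => (A.indicator (fun _ => 1) ω, X ω)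
  have hZ' : Measurable[F t] Z :=
    (measurable_const.indicator hA).prodMk hX
  have hZ : Measurable Z := hZ'.mono (F.le t) le_rfl
  have hX' : Measurable X := hX.mono (F.le t) le_rfl
  have hZY : IndepFun Z Y P :=
    (IndepFun_iff_Indep ..).2 (indep_of_indep_of_le_left hind (measurable_iff_comap_le.1 hZ'))
  have hmap := (indepFun_iff_map_prod_eq_prod_map_map hZ.aemeasurable hY.aemeasurable).1 hZY
  have hPZ : IsProbabilityMeasure (P.map Z) := Measure.isProbabilityMeasure_map hZ.aemeasurable
  have hPY : IsProbabilityMeasure (P.map Y) := Measure.isProbabilityMeasure_map hY.aemeasurable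
  -- The indicator of `A` travels as a coordinate of `Z`, so that independence applies to a single
  -- product integral. Clamping this coordinate to `[0, 1]` bounds `g` everywhere and does not
  -- affect the indicator.
  let g : (ℝ × (ι → EuclideanSpace ℝ (Fin d))) × (ι → EuclideanSpace ℝ (Fin d)) → ℝ :=
    fun p => max 0 (min p.1.1 1) * f (p.1.2 + p.2)
  have hg : Measurable g := by fun_prop
  have hgb : ∀ p, ‖g p‖ ≤ C := by
    intro p
    have h0 : 0 ≤ C := (norm_nonneg _).trans (hC 0)
    have h1 : ‖max 0 (min p.1.1 1)‖ ≤ 1 := by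
      rw [Real.norm_eq_abs, abs_of_nonneg (le_max_left _ _)]
      exact max_le zero_le_one (min_le_right _ _)
    rw [norm_mul]
    calc _ ≤ 1 * C := mul_le_mul h1 (hC _) (norm_nonneg _) zero_le_one
      _ = C := one_mul C
  have hgZ : ∀ ω y, g (Z ω, y) = A.indicator (fun ω => f (X ω + y)) ω := by
    intro ω y
    by_cases hω : ω ∈ A
    · simp [g, Z, hω]
    · simp [g, Z, hω]
  have hA' := (F.le t) _ hA
  calc ∫ ω in A, (∫ ω', f (X ω + Y ω') ∂P) ∂P
      = ∫ ω, ∫ ω', g (Z ω, Y ω') ∂P ∂P := by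
        rw [← integral_indicator hA']
        refine integral_congr_ae (Eventually.of_forall fun ω => ?_)
        simp only [hgZ]
        by_cases hω : ω ∈ A
        · simp [hω]
        · simp [hω]
    _ = ∫ z, ∫ y, g (z, y) ∂(P.map Y) ∂(P.map Z) := by
        rw [integral_map hZ.aemeasurable]
        · refine integral_congr_ae (Eventually.of_forall fun ω => ?_)
          exact (integral_map hY.aemeasurable
            (hg.comp measurable_prodMk_left).aestronglyMeasurable).symm
        · exact (hg.stronglyMeasurable.integral_prod_right').aestronglyMeasurable
    _ = ∫ p, g p ∂((P.map Z).prod (P.map Y)) :=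
        (integral_prod g (Integrable.of_bound hg.aestronglyMeasurable C
          (Eventually.of_forall hgb))).symm
    _ = ∫ ω, g (Z ω, Y ω) ∂P := by
        rw [← hmap, integral_map (hZ.prodMk hY).aemeasurable hg.aestronglyMeasurable]
    _ = ∫ ω in A, f (X ω + Y ω) ∂P := by
        rw [← integral_indicator hA']
        refine integral_congr_ae (Eventually.of_forall fun ω => ?_)
        simp only [hgZ]
        by_cases hω : ω ∈ A
        · simp [hω]
        · simp [hω]

/-- Bounded continuous functions of finitely many values of `B` have continuous versions. -/
lemma exists_isContinuousVersion_comp (hB : IsBrownianMotion P B) (J : Finset (TimeInterval T))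
    {f : (J → EuclideanSpace ℝ (Fin d)) → ℝ} (hf : Continuous f) (hf0 : ∀ x, 0 ≤ f x)
    (hf1 : ∀ x, f x ≤ 1) :
    ∃ N, IsContinuousVersion P (augmentedFiltration P B hB.measurable)
      (fun ω => f fun j => B j ω) N := by
  classical
  let X : TimeInterval T → Ω → J → EuclideanSpace ℝ (Fin d) := fun t ω j => B (min j t) ω
  let Y : TimeInterval T → Ω → J → EuclideanSpace ℝ (Fin d) :=
    fun t ω j => B j ω - B (min j t) ω
  have hfb : ∀ x, ‖f x‖ ≤ 1 := fun x => by
    rw [Real.norm_eq_abs, abs_of_nonneg (hf0 x)]; exact hf1 x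
  have hXF : ∀ t, Measurable[augmentedFiltration P B hB.measurable t] (X t) := fun t =>
    @measurable_pi_lambda _ _ _ (_) _ _ fun j =>
      measurable_augmentedFiltration hB.measurable (min_le_right _ _)
  have hY : ∀ t, Measurable (Y t) := fun t =>
    measurable_pi_lambda _ fun j => (hB.measurable _).sub (hB.measurable _)
  let G : Set Ω := {ω | Continuous fun t => B t ω}
  have hGc : P Gᶜ = 0 := hB.continuous_paths
  have hG : ∀ t, MeasurableSet[augmentedFiltration P B hB.measurable t] G := fun t =>
    (measurableSet_augmentedFiltration_of_null hB.measurable t _ hGc).of_compl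
  -- With the past frozen at `x`, averaging over the independent increments gives the conditional
  -- expectation `Φ t (X t ω)`. It is continuous in `t` by dominated convergence where the path of
  -- `B` is continuous; elsewhere the version is set to `0`.
  let Φ : TimeInterval T → (J → EuclideanSpace ℝ (Fin d)) → ℝ :=
    fun t x => ∫ ω', f (x + Y t ω') ∂P
  have hΦ0 : ∀ t x, 0 ≤ Φ t x := fun t x => integral_nonneg fun ω => hf0 _
  have hint : ∀ t x, Integrable (fun ω' => f (x + Y t ω')) P := fun t x =>
    Integrable.of_bound (hf.measurable.comp ((hY t).const_add x)).aestronglyMeasurable 1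
      (Eventually.of_forall fun ω => hfb _)
  have hΦ1 : ∀ t x, Φ t x ≤ 1 := fun t x => by
    calc Φ t x ≤ ∫ _, (1 : ℝ) ∂P := integral_mono (hint t x) (integrable_const _) fun ω => hf1 _
      _ = 1 := by simp
  have hΦc : ∀ t, Continuous (Φ t) := fun t => by
    refine continuous_of_dominated (bound := fun _ => 1) (fun x => (hint t x).aestronglyMeasurable)
      (fun x => Eventually.of_forall fun ω => hfb _) (integrable_const _)
      (Eventually.of_forall fun ω => by fun_prop)
  refine ⟨fun t => G.indicator fun ω => Φ t (X t ω), fun ω => ?_, fun t => ?_, fun t ω => ?_,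
    fun t ω => ?_, fun t A hA => ?_⟩
  · by_cases hω : ω ∈ G
    · simp only [indicator_of_mem hω]
      have hω' : Continuous fun t => B t ω := hω
      refine continuous_of_dominated (bound := fun _ => 1)
        (fun t => (hint t (X t ω)).aestronglyMeasurable)
        (fun t => Eventually.of_forall fun ω => hfb _) (integrable_const _) ?_
      filter_upwards [hB.continuous_paths] with ω' hω''
      refine hf.comp (continuous_pi fun j => ?_)
      change Continuous fun t => B (min j t) ω + (B j ω' - B (min j t) ω')
      have hmin : Continuous fun t : TimeInterval T => min (j : TimeInterval T) t :=
        continuous_const.min continuous_id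
      exact (hω'.comp hmin).add (continuous_const.sub (hω''.comp hmin))
    · simp only [indicator_of_notMem hω]
      exact continuous_const
  · refine StronglyMeasurable.indicator ?_ (hG t)
    exact ((hΦc t).measurable.comp (hXF t)).stronglyMeasurable
  · exact indicator_nonneg (fun ω _ => hΦ0 t _) ω
  · exact indicator_le' (fun ω _ => hΦ1 t _) (fun ω _ => zero_le_one) ω
  · have hind : Indep (augmentedFiltration P B hB.measurable t)
        (MeasurableSpace.comap (Y t) inferInstance) P := by
      refine indep_of_indep_of_le_right
        (indep_augmentedFiltration hB.measurable hB.zero hB.indep_increments t) ?_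
      refine measurable_iff_comap_le.1 (@measurable_pi_lambda _ _ _ (_) _ _ fun j => ?_)
      exact (measurable_pi_apply (j : TimeInterval T)).comp
        (comap_measurable fun ω (s : TimeInterval T) => B s ω - B (min s t) ω)
    have hfr := setIntegral_add_eq_of_indep (hXF t)
      (hY t) hind hf.measurable hfb hA
    have hXY : ∀ ω, X t ω + Y t ω = fun j : J => B j ω := fun ω => by
      funext j
      simp [X, Y]
    simp only [hXY] at hfr
    rw [← hfr]
    refine integral_congr_ae (ae_restrict_of_ae ?_)
    filter_upwards [hB.continuous_paths] with ω hω
    exact indicator_of_mem (show ω ∈ G from hω) _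

/-- Every bounded martingale `P(A | F t)` of the augmented Brownian filtration has a continuous
version. -/
theorem exists_isContinuousVersion (hB : IsBrownianMotion P B) {A : Set Ω}
    (hA : MeasurableSet[augmentedFiltration P B hB.measurable ⊤] A) :
    ∃ N, IsContinuousVersion P (augmentedFiltration P B hB.measurable)
      (A.indicator fun _ => 1) N := by
  have hF := measurableSet_augmentedFiltration_of_null (P := P) hB.measurable
  have hpi : ∀ J : Finset (TimeInterval T), Measurable fun ω (j : J) => B j ω := fun J =>
    measurable_pi_lambda _ fun j => hB.measurable j
  have hclosed : ∀ (J : Finset (TimeInterval T)) (s : Set (J → EuclideanSpace ℝ (Fin d))),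
      IsClosed s → ∃ N, IsContinuousVersion P (augmentedFiltration P B hB.measurable)
        (((fun ω (j : J) => B j ω) ⁻¹' s).indicator fun _ => 1) N := by
    intro J s hs
    -- The indicator of a closed set is a limit of continuous functions with values in `[0, 1]`.
    have hδ : ∀ n : ℕ, (0 : ℝ) < 1 / ((n : ℝ) + 1) := fun n => Nat.one_div_pos_of_nat
    let f : ℕ → (J → EuclideanSpace ℝ (Fin d)) → ℝ := fun n x => thickenedIndicator (hδ n) s x
    have hf : ∀ n, Continuous (f n) := fun n =>
      NNReal.continuous_coe.comp (thickenedIndicator (hδ n) s).continuous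
    have hf1 : ∀ n x, f n x ≤ 1 := fun n x =>
      NNReal.coe_le_one.2 (thickenedIndicator_le_one (hδ n) s x)
    have hlim := thickenedIndicator_tendsto_indicator_closure hδ
      tendsto_one_div_add_atTop_nhds_zero_nat s
    rw [hs.closure_eq] at hlim
    refine exists_isContinuousVersion_of_tendsto hF (x := fun n ω => f n fun j => B j ω)
      (fun n => exists_isContinuousVersion_comp hB J (hf n) (fun x => NNReal.coe_nonneg _) (hf1 n))
      (fun n => ((hf n).measurable.comp (hpi J)).aestronglyMeasurable) (fun n ω => ?_)
      (Eventually.of_forall fun ω => ?_)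
    · rw [Real.norm_eq_abs, abs_of_nonneg (NNReal.coe_nonneg _)]
      exact hf1 n _
    · have h1 := tendsto_pi_nhds.1 hlim fun j => B j ω
      have h2 := (NNReal.continuous_coe.tendsto _).comp h1
      refine h2.congr' (Eventually.of_forall fun n => rfl) |>.trans (le_of_eq ?_)
      congr 1
      by_cases hω : (fun j : J => B j ω) ∈ s
      · rw [indicator_of_mem hω, indicator_of_mem (show ω ∈ (fun ω (j : J) => B j ω) ⁻¹' s from hω)]
        simp
      · rw [indicator_of_notMem hω,
          indicator_of_notMem (show ω ∉ (fun ω (j : J) => B j ω) ⁻¹' s from hω)]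
        simp
  have hcyl : ∀ (J : Finset (TimeInterval T)) (s : Set (J → EuclideanSpace ℝ (Fin d))),
      MeasurableSet s → ∃ N, IsContinuousVersion P (augmentedFiltration P B hB.measurable)
        (((fun ω (j : J) => B j ω) ⁻¹' s).indicator fun _ => 1) N := fun J s hs =>
    exists_isContinuousVersion_of_generateFrom hF (hpi J) isPiSystem_isClosed
      (BorelSpace.measurable_eq.trans borel_eq_generateFrom_isClosed) (hclosed J) hs
  -- Up to a null set, an event of `F ⊤` is an event of the path of `B`, and cylinders generate
  -- these.
  rw [augmentedFiltration_apply] at hA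
  obtain ⟨A', ⟨s, hs, rfl⟩, hAA'⟩ := exists_measurableSet_ae_eq_of_sup_null hA
  have hpath : Measurable fun ω (j : Iic (⊤ : TimeInterval T)) => B j ω :=
    measurable_pi_lambda _ fun j => hB.measurable j
  obtain ⟨N, hN⟩ := exists_isContinuousVersion_of_generateFrom hF hpath
    (isPiSystem_measurableCylinders (α := fun _ : Iic (⊤ : TimeInterval T) =>
      EuclideanSpace ℝ (Fin d)))
    generateFrom_measurableCylinders.symm (fun c hc => by
      obtain ⟨J, S, hS, rfl⟩ := (mem_measurableCylinders c).1 hc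
      classical
      let J' : Finset (TimeInterval T) := J.image Subtype.val
      let ψ : (J' → EuclideanSpace ℝ (Fin d)) → (J → EuclideanSpace ℝ (Fin d)) :=
        fun x j => x ⟨j.1.1, Finset.mem_image_of_mem _ j.2⟩
      have hψ : Measurable ψ := measurable_pi_lambda _ fun j => measurable_pi_apply _
      exact hcyl J' (ψ ⁻¹' S) (hψ hS)) hs
  exact ⟨N, hN.congr_ae (indicator_ae_eq_of_ae_eq_set hAA').symm⟩

end Independence

/-! ### Predictable processes -/

section Predictable

variable {F : Filtration (TimeInterval T) m}

lemma measurable_fst_predictable :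
    Measurable[F.predictable] (Prod.fst : TimeInterval T × Ω → TimeInterval T) := by
  let : MeasurableSpace (TimeInterval T × Ω) := F.predictable
  refine measurable_of_Ioi fun i => ?_
  have : (Prod.fst : TimeInterval T × Ω → TimeInterval T) ⁻¹' Ioi i = Ioi i ×ˢ univ := by
    ext p; simp
  rw [this]
  exact measurableSet_predictable_Ioi_prod (@MeasurableSet.univ _ (F i))

/-- Continuous adapted processes are predictable. -/
lemma isStronglyPredictable_of_continuous {N : TimeInterval T → Ω → ℝ}
    (hc : ∀ ω, Continuous fun t => N t ω) (ha : StronglyAdapted F N) :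
    IsStronglyPredictable F N := by
  let : MeasurableSpace (TimeInterval T × Ω) := F.predictable
  refine (measurable_of_Ioi fun c => ?_ : Measurable (uncurry N)).stronglyMeasurable
  have hlt : ∀ t (a : ℝ), MeasurableSet[F t] {ω | N t ω < a} := fun t a =>
    (ha t).measurableSet_lt stronglyMeasurable_const
  -- By continuity, at `t > 0` one has `N > c` exactly when, for some dense time `q < t` and some
  -- rational `a > c`, `N ≥ a` at all dense times of `]q, t[`. Only values strictly before `t`
  -- enter, so predictable rectangles suffice.
  have heq : uncurry N ⁻¹' Ioi c = ({⊥} ×ˢ {ω | c < N ⊥ ω}) ∪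
      ⋃ (k : ℕ) (a : {a : ℚ // c < a}),
        (Ioi (timeSeq T k) ×ˢ univ) \
          ⋃ j : {j : ℕ // timeSeq T k < timeSeq T j},
            Ioi (timeSeq T j) ×ˢ {ω | N (timeSeq T j) ω < (a : ℚ)} := by
    ext ⟨t, ω⟩
    simp only [mem_preimage, uncurry, mem_Ioi, mem_union, mem_prod, mem_singleton_iff, mem_iUnion,
      Set.mem_sdiff, mem_univ, and_true, not_exists, not_and, not_lt, mem_ofPred_eq, Subtype.exists,
      exists_prop]
    constructor
    · intro h
      rcases eq_or_lt_of_le (bot_le : ⊥ ≤ t) with rfl | ht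
      · exact Or.inl ⟨rfl, h⟩
      · refine Or.inr ?_
        obtain ⟨a, ha1, ha2⟩ := exists_rat_btwn h
        have hev : ∀ᶠ s in 𝓝[<] t, (a : ℝ) < N s ω :=
          (((hc ω).tendsto t).eventually_const_lt ha2).filter_mono nhdsWithin_le_nhds
        obtain ⟨q₀, hq₀, hq₀'⟩ := (mem_nhdsLT_iff_exists_Ioo_subset' ht).1 hev
        obtain ⟨k, hk⟩ := exists_timeSeq_mem_Ioo hq₀
        refine ⟨k, a, ha1, hk.2, fun j hj hjt => ?_⟩
        exact le_of_lt (hq₀' ⟨hk.1.trans hj, hjt⟩)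
    · rintro (⟨rfl, h⟩ | ⟨k, a, ha1, hkt, hj⟩)
      · exact h
      · refine ha1.trans_le ?_
        by_contra hcon
        push Not at hcon
        have hev : ∀ᶠ s in 𝓝[<] t, N s ω < a :=
          (((hc ω).tendsto t).eventually_lt_const hcon).filter_mono nhdsWithin_le_nhds
        obtain ⟨q₀, hq₀, hq₀'⟩ := (mem_nhdsLT_iff_exists_Ioo_subset'
          (bot_le.trans_lt hkt)).1 hev
        obtain ⟨j, hj'⟩ := exists_timeSeq_mem_Ioo (max_lt hkt hq₀)
        have h1 := hj j ((le_max_left _ _).trans_lt hj'.1) hj'.2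
        exact absurd (hq₀' ⟨(le_max_right _ _).trans_lt hj'.1, hj'.2⟩) (not_lt.2 h1)
  rw [heq]
  refine MeasurableSet.union (measurableSet_predictable_singleton_bot_prod
    (stronglyMeasurable_const.measurableSet_lt (ha ⊥))) ?_
  refine MeasurableSet.iUnion fun k => MeasurableSet.iUnion fun a => ?_
  refine MeasurableSet.diff (measurableSet_predictable_Ioi_prod (@MeasurableSet.univ _ (F _))) ?_
  exact MeasurableSet.iUnion fun j => measurableSet_predictable_Ioi_prod (hlt _ _)

/-! ### Stochastic intervals ending when `K` reaches a level -/

variable {K : TimeInterval T → Ω → ℝ}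

open Classical in
/-- The indicator of the stochastic interval from `q` to the first time at which `K` reaches
`c`. -/
noncomputable def activity (K : TimeInterval T → Ω → ℝ) (q : TimeInterval T) (c : ℝ)
    (t : TimeInterval T) (ω : Ω) : ℝ :=
  if q ≤ t ∧ K t ω < c then 1 else 0

lemma activity_nonneg (q : TimeInterval T) (c : ℝ) (t : TimeInterval T) (ω : Ω) :
    0 ≤ activity K q c t ω := by
  unfold activity
  split_ifs <;> norm_num

/-- Taking left limits turns `[q, σ[` into `]q, σ]`, which contains a possible jump time `σ` of `K`;
this is the interval used in `ae_le_max_envelope`. -/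
lemma IsK.activity_leftLimit (hK : IsK F K) (q : TimeInterval T) (c : ℝ) (t : TimeInterval T)
    (ω : Ω) [Decidable (q < t ∧ ∀ s < t, K s ω < c)] :
    Tendsto (fun s => activity K q c s ω) (𝓝[<] t)
      (𝓝 (if q < t ∧ ∀ s < t, K s ω < c then 1 else 0)) := by
  refine tendsto_const_nhds.congr' ?_
  split_ifs with h
  · filter_upwards [Ioo_mem_nhdsLT h.1] with s hs
    exact (if_pos ⟨hs.1.le, h.2 s hs.2⟩).symm
  · rw [not_and_or] at h
    rcases h with h | h
    · filter_upwards [self_mem_nhdsWithin] with s hs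
      exact (if_neg fun h' => h (h'.1.trans_lt hs)).symm
    · push Not at h
      obtain ⟨s₀, hs₀, hc⟩ := h
      filter_upwards [Ioo_mem_nhdsLT hs₀] with s hs
      exact (if_neg fun h' => absurd h'.2 (not_lt.2 (hc.trans (hK.monotone ω hs.1.le)))).symm

/-- To the right of a time, `K < c` persists by right continuity and `K ≥ c` by monotonicity. -/
lemma IsK.isD_activity (hK : IsK F K) (q : TimeInterval T) (c : ℝ) :
    IsD F (activity K q c) where
  predictable := by
    classical
    have hset : MeasurableSet[F.predictable]
        {p : TimeInterval T × Ω | q ≤ p.1 ∧ K p.1 p.2 < c} := by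
      refine MeasurableSet.inter (measurable_fst_predictable measurableSet_Ici) ?_
      exact StronglyMeasurable.measurableSet_lt hK.predictable stronglyMeasurable_const
    exact StronglyMeasurable.ite hset stronglyMeasurable_const stronglyMeasurable_const
  right_continuous ω t := by
    have : ∀ᶠ s in 𝓝[≥] t, activity K q c s ω = activity K q c t ω := by
      by_cases hq : q ≤ t
      · by_cases hc : K t ω < c
        · filter_upwards [(hK.right_continuous ω t).eventually_lt_const hc, self_mem_nhdsWithin]
            with s hs hts
          unfold activity
          rw [if_pos ⟨hq.trans hts, hs⟩, if_pos ⟨hq, hc⟩]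
        · filter_upwards [self_mem_nhdsWithin] with s hts
          unfold activity
          rw [if_neg fun h => hc ((hK.monotone ω hts).trans_lt h.2), if_neg fun h => hc h.2]
      · filter_upwards [mem_nhdsWithin_of_mem_nhds (Iio_mem_nhds (not_le.1 hq))] with s hs
        unfold activity
        rw [if_neg fun h => absurd h.1 (not_le.2 hs), if_neg fun h => hq h.1]
    exact tendsto_const_nhds.congr' (this.mono fun s hs => hs.symm)
  left_limits ω t := by
    classical
    exact ⟨_, hK.activity_leftLimit q c t ω⟩

lemma IsK.leftValue_activity (hK : IsK F K) (q : TimeInterval T) (c : ℝ) {t : TimeInterval T}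
    (ht : ⊥ < t) (ω : Ω) [Decidable (q < t ∧ ∀ s < t, K s ω < c)] :
    leftValue (activity K q c) t ω = if q < t ∧ ∀ s < t, K s ω < c then 1 else 0 := by
  have := nhdsLT_neBot ht
  exact leftLim_eq_of_tendsto (hK.activity_leftLimit q c t ω)

/-! ### The competitor -/

variable {Y L N R : TimeInterval T → Ω → ℝ}

/-- The process obtained from `Y` by lowering it towards `L ∨ r`, at most by `N R`. -/
noncomputable def lowered (Y L N R : TimeInterval T → Ω → ℝ) (r : ℝ) (t : TimeInterval T)
    (ω : Ω) : ℝ :=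
  max (Y t ω - N t ω * R t ω) (min (Y t ω) (max (L t ω) r))

lemma tendsto_lowered (hY : IsD F Y) (hL : IsD F L) (hR : IsD F R)
    (hN : ∀ ω, Continuous fun t => N t ω) (r : ℝ) (t : TimeInterval T) (ω : Ω) :
    Tendsto (fun s => lowered Y L N R r s ω) (𝓝[<] t)
      (𝓝 (max (leftValue Y t ω - N t ω * leftValue R t ω)
        (min (leftValue Y t ω) (max (leftValue L t ω) r)))) := by
  have h1 := tendsto_leftLim (hY.left_limits ω t)
  have h2 := tendsto_leftLim (hL.left_limits ω t)
  have h3 := tendsto_leftLim (hR.left_limits ω t)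
  have h4 := ((hN ω).tendsto t).mono_left (nhdsWithin_le_nhds (s := Iio t))
  exact (h1.sub (h4.mul h3)).max (h1.min (h2.max tendsto_const_nhds))

lemma isD_lowered (hY : IsD F Y) (hL : IsD F L) (hR : IsD F R)
    (hN : ∀ ω, Continuous fun t => N t ω) (hN' : StronglyAdapted F N) (r : ℝ) :
    IsD F (lowered Y L N R r) where
  predictable := by
    have h1 := hY.predictable
    have h2 := hL.predictable
    have h3 := hR.predictable
    have h4 := isStronglyPredictable_of_continuous hN hN'
    have hcont : Continuous fun x : ℝ × ℝ × ℝ × ℝ =>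
        max (x.1 - x.2.2.1 * x.2.2.2) (min x.1 (max x.2.1 r)) := by fun_prop
    exact hcont.comp_stronglyMeasurable (h1.prodMk (h2.prodMk (h4.prodMk h3)))
  right_continuous ω t := by
    have h1 := hY.right_continuous ω t
    have h2 := hL.right_continuous ω t
    have h3 := hR.right_continuous ω t
    have h4 := (hN ω).continuousWithinAt (s := Ici t) (x := t)
    exact (h1.sub (h4.mul h3)).max (h1.min (h2.max continuousWithinAt_const))
  left_limits ω t := ⟨_, tendsto_lowered hY hL hR hN r t ω⟩

lemma leftValue_lowered (hY : IsD F Y) (hL : IsD F L) (hR : IsD F R)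
    (hN : ∀ ω, Continuous fun t => N t ω) (r : ℝ) (t : TimeInterval T) (ω : Ω) :
    leftValue (lowered Y L N R r) t ω =
      max (leftValue Y t ω - N t ω * leftValue R t ω)
        (min (leftValue Y t ω) (max (leftValue L t ω) r)) := by
  refine leftLim_eq_of_tendsto_of_bot (tendsto_lowered hY hL hR hN r t ω) ?_
  rintro rfl
  simp only [leftValue, leftLim_bot, lowered]

end Predictable

/-! ### Minimality against all competitors -/

section Minimality

variable {P : Measure Ω} [IsProbabilityMeasure P] {F : Filtration (TimeInterval T) m}
  {Y L h ρ K : TimeInterval T → Ω → ℝ}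

/-- If `Y_- ≤ X_-` holds `dK`-almost everywhere for all the processes `X ≤ Y` of `𝒟` that satisfy
the lower constraints, then `Y_- ≤ L_- ∨ h^{*,ρ}` holds `dK`-almost everywhere. -/
theorem ae_leftValue_le_max_envelope
    (hver : ∀ A, MeasurableSet[F ⊤] A → ∃ N, IsContinuousVersion P F (A.indicator fun _ => 1) N)
    (hY : IsD F Y) (hL : IsD F L) (hh : IsStronglyPredictable F h) (hρ : IsK F ρ) (hK : IsK F K)
    (hYh : ∀ᵐ ω ∂P, ∀ᵐ t ∂(pathMeasure ρ ω), h t ω ≤ leftValue Y t ω)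
    (hmin : ∀ X, IsD F X → (∀ t ω, leftValue X t ω ≤ leftValue Y t ω) →
      (∀ t ω, min (leftValue Y t ω) (leftValue L t ω) ≤ leftValue X t ω) →
      (∀ᵐ ω ∂P, ∀ᵐ t ∂(pathMeasure ρ ω), h t ω ≤ leftValue X t ω) →
      ∀ᵐ ω ∂P, ∀ᵐ t ∂(pathMeasure K ω), leftValue Y t ω ≤ leftValue X t ω) :
    ∀ᵐ ω ∂P, ∀ᵐ t ∂(pathMeasure K ω),
      ((leftValue Y t ω : ℝ) : EReal) ≤ max ((leftValue L t ω : ℝ) : EReal)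
        (envelope h ρ t ω) := by
  classical
  have hhp := isProgressive_of_predictable hh
  suffices H : ∀ᵐ ω ∂P, ∀ (k : ℕ) (r c : ℚ),
      pathMeasure ρ ω {s | (timeSeq T k < s ∧ ∀ s' < s, K s' ω < c) ∧ (r : ℝ) < h s ω} = 0 →
      ∀ᵐ t ∂(pathMeasure K ω), timeSeq T k < t ∧ (∀ s' < t, K s' ω < c) →
        leftValue Y t ω ≤ max (leftValue L t ω) r by
    filter_upwards [H] with ω hω
    exact ae_le_max_envelope (x := fun t => leftValue L t ω) (y := fun t => leftValue Y t ω)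
      hK (hhp.measurable_path ω) hω
  refine ae_all_iff.2 fun k => ae_all_iff.2 fun r => ae_all_iff.2 fun c => ?_
  set q := timeSeq T k
  set R := activity K q (c : ℝ)
  have hR : IsD F R := hK.isD_activity q c
  -- `S` collects the violations of `h ≤ r` on the stochastic interval; below, `G t` is the event
  -- that none has been charged by `dρ` up to `t`, and `N` is the conditional probability of `G ⊤`.
  let S : Set (TimeInterval T × Ω) := {p | (r : ℝ) < h p.1 p.2 ∧ 0 < leftValue R p.1 p.2}
  have hSm : ∀ t, MeasurableSet[(inferInstance : MeasurableSpace (TimeInterval T)).prod (F t)]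
      {p : TimeInterval T × Ω | (min p.1 t, p.2) ∈ S} := fun t =>
    ((hhp t) measurableSet_Ioi).inter ((hR.isProgressive_leftValue t) measurableSet_Ioi)
  have hSpath : ∀ ω, MeasurableSet {s | (s, ω) ∈ S} := fun ω =>
    ((hhp.measurable_path ω) measurableSet_Ioi).inter
      ((hR.isProgressive_leftValue.measurable_path ω) measurableSet_Ioi)
  let G : TimeInterval T → Set Ω := fun t => {ω | pathMeasure ρ ω {s | s ≤ t ∧ (s, ω) ∈ S} = 0}
  have hG : ∀ t, MeasurableSet[F t] (G t) := fun t => hρ.measurableSet_null t (hSm t)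
  obtain ⟨N, hN⟩ := hver (G ⊤) (hG ⊤)
  have hzero : ∀ t, ∀ᵐ ω ∂P, ω ∈ (G t)ᶜ → N t ω = 0 := fun t =>
    hN.ae_eq_zero t (hG t).compl (disjoint_compl_right_iff_subset.2 fun ω hω =>
      measure_mono_null (t := {s | s ≤ ⊤ ∧ (s, ω) ∈ S}) (fun s hs => ⟨le_top, hs.2⟩) hω)
  have hpos := hN.ae_pos (F.le ⊤ _ (hG ⊤))
  have hX := isD_lowered hY hL hR hN.continuous hN.adapted (r : ℝ)
  have hXl := leftValue_lowered hY hL hR hN.continuous (r : ℝ)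
  have hR0 : ∀ t ω, 0 ≤ leftValue R t ω := fun t ω =>
    ge_of_tendsto' (tendsto_leftValue hR.left_limits t ω) fun n => activity_nonneg q c _ ω
  have hXh : ∀ᵐ ω ∂P, ∀ᵐ t ∂(pathMeasure ρ ω), h t ω ≤ leftValue (lowered Y L N R r) t ω := by
    filter_upwards [hYh, ae_all_iff.2 fun j => hzero (timeSeq T j), hzero ⊤] with ω hω hz hztop
    -- The vanishing of `N` off `G t` is almost sure for each fixed `t`, hence available at
    -- countably many times. If `N` is nonzero at `t < ⊤`, it is so at a slightly later dense time,
    -- whose event contains the claim at `t`; the final time is treated separately.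
    have hnull : ∀ t, N t ω ≠ 0 → pathMeasure ρ ω {s | s ≤ t ∧ (s, ω) ∈ S} = 0 := by
      intro t ht
      rcases eq_or_lt_of_le (le_top : t ≤ ⊤) with rfl | htop
      · by_contra hcon
        exact ht (hztop hcon)
      · have hU : IsOpen {s | N s ω ≠ 0} := isOpen_ne_fun (hN.continuous ω) continuous_const
        have hne : ({s | N s ω ≠ 0} ∩ Ioi t).Nonempty := by
          have := nhdsGT_neBot_of_exists_gt ⟨⊤, htop⟩
          exact nonempty_of_mem (inter_mem (mem_nhdsWithin_of_mem_nhds (hU.mem_nhds ht))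
            (self_mem_nhdsWithin (s := Ioi t) (a := t)))
        obtain ⟨j, hj, hjt⟩ := exists_timeSeq_of_isOpen (hU.inter isOpen_Ioi) hne
        have : ω ∈ G (timeSeq T j) := by
          by_contra hcon
          exact hj (hz j hcon)
        exact measure_mono_null (t := {s | s ≤ timeSeq T j ∧ (s, ω) ∈ S})
          (fun s hs => ⟨hs.1.trans (le_of_lt hjt), hs.2⟩) this
    -- So `dρ`-almost every violation occurs where `N` is already zero, where the competitor is not
    -- lowered.
    have hbad : (pathMeasure ρ ω).restrict {s | (s, ω) ∈ S} {t | N t ω ≠ 0} = 0 := by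
      refine measure_eq_zero_of_forall_Icc fun a _ b hb _ => ?_
      rw [Measure.restrict_apply' (hSpath ω)]
      exact measure_mono_null (t := {s | s ≤ b ∧ (s, ω) ∈ S})
        (fun s hs => ⟨hs.1.2, hs.2⟩) (hnull b hb)
    rw [Measure.restrict_apply' (hSpath ω)] at hbad
    filter_upwards [hω, measure_eq_zero_iff_ae_notMem.1 hbad] with t ht hbt
    rw [hXl]
    rcases le_or_gt (h t ω) r with hr | hr
    · exact le_max_of_le_right (le_min ht (le_max_of_le_right hr))
    · refine le_max_of_le_left ?_
      rcases (hR0 t ω).eq_or_lt with h0 | h0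
      · rw [← h0, mul_zero, sub_zero]
        exact ht
      · have hN0 : N t ω = 0 := by
          by_contra hcon
          exact hbt ⟨hcon, hr, h0⟩
        rw [hN0, zero_mul, sub_zero]
        exact ht
  have hfin := hmin _ hX
    (fun t ω => by
      rw [hXl]
      exact max_le (sub_le_self _ (mul_nonneg (hN.nonneg t ω) (hR0 t ω))) (min_le_left _ _))
    (fun t ω => by
      rw [hXl]
      exact le_max_of_le_right (min_le_min_left _ (le_max_left _ _)))
    hXh
  filter_upwards [hfin, hpos] with ω hω hposω hnull
  have hωG : ω ∈ G ⊤ := by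
    refine measure_mono_null (t := {s | (timeSeq T k < s ∧ ∀ s' < s, K s' ω < c) ∧
      (r : ℝ) < h s ω} ∪ {⊥}) ?_ (measure_union_null hnull (hρ.pathMeasure_bot ω))
    rintro s ⟨_, hs1, hs2⟩
    rcases eq_or_lt_of_le (bot_le : ⊥ ≤ s) with rfl | hs
    · exact Or.inr rfl
    · refine Or.inl ⟨?_, hs1⟩
      by_contra hcon
      have hs2' : 0 < leftValue R s ω := hs2
      rw [hK.leftValue_activity q c hs ω, if_neg hcon] at hs2'
      exact lt_irrefl _ hs2'
  filter_upwards [hω] with t ht hact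
  rw [hXl, hK.leftValue_activity q c (bot_le.trans_lt hact.1) ω, if_pos hact, mul_one] at ht
  have hNt := hposω hωG t
  -- The first alternative would read `Y_- ≤ Y_- - N`, impossible since `N > 0` on `G ⊤`.
  rcases le_max_iff.1 ht with h1 | h1
  · linarith
  · exact h1.trans (min_le_right _ _)

end Minimality

/-! ### Comparison of the two minimality conditions -/

section Comparison

variable {F : Filtration (TimeInterval T) m}

lemma IsD.neg {Y : TimeInterval T → Ω → ℝ} (hY : IsD F Y) : IsD F fun t ω => -Y t ω where
  predictable := StronglyMeasurable.neg hY.predictable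
  right_continuous ω t := (hY.right_continuous ω t).neg
  left_limits ω t := let ⟨_, hy⟩ := hY.left_limits ω t
    ⟨_, hy.neg⟩

lemma IsD.leftValue_neg {Y : TimeInterval T → Ω → ℝ} (hY : IsD F Y) (t : TimeInterval T) (ω : Ω) :
    leftValue (fun t ω => -Y t ω) t ω = -leftValue Y t ω :=
  leftLim_neg _ t (hY.left_limits ω t)

lemma toENNReal_sub_eq_zero_iff {x y : EReal} : (x - y).toENNReal = 0 ↔ x ≤ y :=
  EReal.toENNReal_eq_zero_iff.trans EReal.sub_nonpos

lemma lintegral_add₄_eq_zero_iff {P : Measure Ω} {a b c e : Ω → ℝ≥0∞} (ha : Measurable a)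
    (hb : Measurable b) (hc : Measurable c) :
    ∫⁻ ω, (a ω + b ω + c ω + e ω) ∂P = 0 ↔
      ∫⁻ ω, a ω ∂P = 0 ∧ ∫⁻ ω, b ω ∂P = 0 ∧ ∫⁻ ω, c ω ∂P = 0 ∧ ∫⁻ ω, e ω ∂P = 0 := by
  have hab : Measurable fun ω => a ω + b ω := ha.add hb
  have habc : Measurable fun ω => a ω + b ω + c ω := hab.add hc
  rw [lintegral_add_left habc, lintegral_add_left hab, lintegral_add_left ha]
  simp only [add_eq_zero, and_assoc]

namespace Data

variable (D : Data F d) {P : Measure Ω}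

/-- Membership in `Dom` in almost sure form. -/
lemma mem_Dom_iff {Y : TimeInterval T → Ω → ℝ} : Y ∈ D.Dom P ↔ IsD F Y ∧
    (∀ᵐ ω ∂P, ∀ᵐ t ∂(lebesgue T), leftValue D.L t ω ≤ leftValue Y t ω) ∧
    (∀ᵐ ω ∂P, ∀ᵐ t ∂(pathMeasure D.δ ω), D.l t ω ≤ leftValue Y t ω) ∧
    (∀ᵐ ω ∂P, ∀ᵐ t ∂(lebesgue T), leftValue Y t ω ≤ leftValue D.U t ω) ∧
    (∀ᵐ ω ∂P, ∀ᵐ t ∂(pathMeasure D.α ω), leftValue Y t ω ≤ D.u t ω) := by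
  refine and_congr_right fun hY => ?_
  have hL := D.isD_L.isProgressive_leftValue
  have hU := D.isD_U.isProgressive_leftValue
  have hl := isProgressive_of_predictable D.predictable_l
  have hu := isProgressive_of_predictable D.predictable_u
  have hYp := hY.isProgressive_leftValue
  rw [← lintegral_lebesgue_sub_eq_zero_iff P hL hYp, ← lintegral_lebesgue_sub_eq_zero_iff P hYp hU,
    ← D.isK_δ.lintegral_sub_eq_zero_iff P hl hYp, ← D.isK_α.lintegral_sub_eq_zero_iff P hYp hu]
  have m1 := measurable_lintegral_lebesgue_sub hL hYp
  have m2 := D.isK_δ.measurable_lintegral_sub hl hYp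
  have m3 := measurable_lintegral_lebesgue_sub hYp hU
  exact lintegral_add₄_eq_zero_iff m1 m2 m3

/-- Membership in `Dom` in terms of the two barriers. -/
lemma mem_Dom_iff_barriers {Y : TimeInterval T → Ω → ℝ} (hY : IsD F Y) :
    Y ∈ D.Dom P ↔ ∀ᵐ ω ∂P, ∀ t : TimeInterval T, ⊥ < t →
      D.lowerBarrier t ω ≤ ((leftValue Y t ω : ℝ) : EReal) ∧
      ((leftValue Y t ω : ℝ) : EReal) ≤ D.upperBarrier t ω := by
  have hl := isProgressive_of_predictable D.predictable_l
  have hu := isProgressive_of_predictable D.predictable_u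
  have hlow : ∀ ω, _ := fun ω => ae_le_iff_max_envelope_le (h := D.l) (ω := ω) D.isK_δ
    (hl.measurable_path ω) (hY.isCadlag ω) (D.isD_L.isCadlag ω)
  -- The upper constraints on `Y` are lower constraints on `-Y`, with `-U` and `-u`.
  have hupp : ∀ ω, _ := fun ω => ae_le_iff_max_envelope_le (h := fun s ω => -D.u s ω) (ω := ω)
    D.isK_α (hu.measurable_path ω).neg (hY.neg.isCadlag ω) (D.isD_U.neg.isCadlag ω)
  have hupp' : ∀ t ω, ((leftValue Y t ω : ℝ) : EReal) ≤ D.upperBarrier t ω ↔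
      max ((leftValue (fun s ω => -D.U s ω) t ω : ℝ) : EReal)
        (envelope (fun s ω => -D.u s ω) D.α t ω) ≤
        ((leftValue (fun s ω => -Y s ω) t ω : ℝ) : EReal) := by
    intro t ω
    rw [D.isD_U.leftValue_neg, hY.leftValue_neg, max_le_iff, upperBarrier, le_min_iff,
      EReal.coe_neg, EReal.coe_neg, EReal.neg_le_neg_iff, EReal.le_neg]
  rw [mem_Dom_iff, and_iff_right hY]
  simp only [hupp', forall_and]
  rw [eventually_and]
  constructor
  · rintro ⟨h1, h2, h3, h4⟩
    constructor
    · filter_upwards [h1, h2] with ω a b using (hlow ω).1 ⟨a, b⟩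
    · filter_upwards [h3, h4] with ω a b
      refine (hupp ω).1 ⟨?_, ?_⟩
      · filter_upwards [a] with t ht
        have h5 := D.isD_U.leftValue_neg t ω
        have h6 := hY.leftValue_neg t ω
        rw [leftValue] at h5 h6
        rw [h5, h6]
        exact neg_le_neg ht
      · filter_upwards [b] with t ht
        have h6 := hY.leftValue_neg t ω
        rw [leftValue] at h6
        rw [h6]
        exact neg_le_neg ht
  · rintro ⟨h1, h2⟩
    have hlow' : ∀ᵐ ω ∂P, _ := h1.mono fun ω => (hlow ω).2
    have hupp'' : ∀ᵐ ω ∂P, _ := h2.mono fun ω => (hupp ω).2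
    refine ⟨hlow'.mono fun ω h => h.1, hlow'.mono fun ω h => h.2, ?_, ?_⟩
    · filter_upwards [hupp''] with ω h
      filter_upwards [h.1] with t ht
      have h5 := D.isD_U.leftValue_neg t ω
      have h6 := hY.leftValue_neg t ω
      rw [leftValue] at h5 h6
      rw [h5, h6] at ht
      exact neg_le_neg_iff.1 ht
    · filter_upwards [hupp''] with ω h
      filter_upwards [h.2] with t ht
      have h6 := hY.leftValue_neg t ω
      rw [leftValue] at h6
      rw [h6] at ht
      exact neg_le_neg_iff.1 ht

lemma measurable_lowerBarrier (ω : Ω) : Measurable fun t => D.lowerBarrier t ω :=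
  (measurable_coe_real_ereal.comp (D.isD_L.isProgressive_leftValue.measurable_path ω)).max
    measurable_envelope

lemma measurable_upperBarrier (ω : Ω) : Measurable fun t => D.upperBarrier t ω :=
  (measurable_coe_real_ereal.comp (D.isD_U.isProgressive_leftValue.measurable_path ω)).min
    measurable_envelope.neg

lemma lintegral_sub_lowerBarrier_eq_zero_iff {Y K : TimeInterval T → Ω → ℝ} (hY : IsD F Y)
    (ω : Ω) : ∫⁻ t, (((leftValue Y t ω : ℝ) : EReal) - D.lowerBarrier t ω).toENNReal
        ∂(pathMeasure K ω) = 0 ↔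
      ∀ᵐ t ∂(pathMeasure K ω), ((leftValue Y t ω : ℝ) : EReal) ≤ D.lowerBarrier t ω := by
  have hYm := measurable_coe_real_ereal.comp (hY.isProgressive_leftValue.measurable_path ω)
  have hm : Measurable fun t =>
      (((leftValue Y t ω : ℝ) : EReal) - D.lowerBarrier t ω).toENNReal :=
    measurable_ereal_toENNReal.comp (hYm.add (D.measurable_lowerBarrier ω).neg)
  rw [lintegral_eq_zero_iff hm]
  exact eventually_congr (Eventually.of_forall fun t => toENNReal_sub_eq_zero_iff)

lemma lintegral_upperBarrier_sub_eq_zero_iff {Y K : TimeInterval T → Ω → ℝ} (hY : IsD F Y)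
    (ω : Ω) : ∫⁻ t, (D.upperBarrier t ω - ((leftValue Y t ω : ℝ) : EReal)).toENNReal
        ∂(pathMeasure K ω) = 0 ↔
      ∀ᵐ t ∂(pathMeasure K ω), D.upperBarrier t ω ≤ ((leftValue Y t ω : ℝ) : EReal) := by
  have hYm := measurable_coe_real_ereal.comp (hY.isProgressive_leftValue.measurable_path ω)
  have hm : Measurable fun t =>
      (D.upperBarrier t ω - ((leftValue Y t ω : ℝ) : EReal)).toENNReal :=
    measurable_ereal_toENNReal.comp ((D.measurable_upperBarrier ω).add hYm.neg)
  rw [lintegral_eq_zero_iff hm]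
  exact eventually_congr (Eventually.of_forall fun t => toENNReal_sub_eq_zero_iff)

/-- The minimality condition for one competitor, in almost sure form. -/
lemma minimality_iff {Y X Kp Km : TimeInterval T → Ω → ℝ} (hY : IsD F Y) (hX : IsD F X)
    (hKp : IsK F Kp) (hKm : IsK F Km) :
    ∫⁻ ω, (∫⁻ t, ENNReal.ofReal (leftValue Y t ω - leftValue X t ω) ∂(pathMeasure Kp ω)
      + ∫⁻ t, ENNReal.ofReal (leftValue X t ω - leftValue Y t ω) ∂(pathMeasure Km ω)) ∂P = 0 ↔
    (∀ᵐ ω ∂P, ∀ᵐ t ∂(pathMeasure Kp ω), leftValue Y t ω ≤ leftValue X t ω) ∧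
    (∀ᵐ ω ∂P, ∀ᵐ t ∂(pathMeasure Km ω), leftValue X t ω ≤ leftValue Y t ω) := by
  have hYp := hY.isProgressive_leftValue
  have hXp := hX.isProgressive_leftValue
  rw [← hKp.lintegral_sub_eq_zero_iff P hYp hXp, ← hKm.lintegral_sub_eq_zero_iff P hXp hYp,
    lintegral_add_left (hKp.measurable_lintegral_sub hYp hXp), add_eq_zero]

/-- The Skorokhod conditions imply minimality against all competitors. -/
lemma IsStandardSolution.isSolution {B : TimeInterval T → Ω → EuclideanSpace ℝ (Fin d)}
    {Y : TimeInterval T → Ω → ℝ} {Z : TimeInterval T → Ω → EuclideanSpace ℝ (Fin d)}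
    {Kp Km : TimeInterval T → Ω → ℝ} {D : Data F d} (h : D.IsStandardSolution P B Y Z Kp Km) :
    D.IsSolution P B Y Z Kp Km where
  mem_dom := (D.mem_Dom_iff_barriers h.isD).2 h.barriers
  isL2 := h.isL2
  isK_plus := h.isK_plus
  isK_minus := h.isK_minus
  singular := h.singular
  equation := h.equation
  minimality X hX := by
    have hXb := (D.mem_Dom_iff_barriers hX.1).1 hX
    rw [minimality_iff h.isD hX.1 h.isK_plus h.isK_minus]
    constructor
    · filter_upwards [hXb, h.skorokhod_plus] with ω h1 h2
      -- The barriers bound the competitor only at positive times, which is enough because `dK⁺` has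
      -- no mass at `0`.
      filter_upwards [(D.lintegral_sub_lowerBarrier_eq_zero_iff h.isD ω).1 h2,
        h.isK_plus.ae_bot_lt ω] with t h3 ht
      exact EReal.coe_le_coe_iff.1 (h3.trans (h1 t ht).1)
    · filter_upwards [hXb, h.skorokhod_minus] with ω h1 h2
      filter_upwards [(D.lintegral_upperBarrier_sub_eq_zero_iff h.isD ω).1 h2,
        h.isK_minus.ae_bot_lt ω] with t h3 ht
      exact EReal.coe_le_coe_iff.1 ((h1 t ht).2.trans h3)

/-- If all the events have continuous conditional probabilities, minimality against all competitors
implies the Skorokhod conditions. -/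
lemma IsSolution.isStandardSolution [IsProbabilityMeasure P]
    (hver : ∀ A, MeasurableSet[F ⊤] A → ∃ N, IsContinuousVersion P F (A.indicator fun _ => 1) N)
    {B : TimeInterval T → Ω → EuclideanSpace ℝ (Fin d)}
    {Y : TimeInterval T → Ω → ℝ} {Z : TimeInterval T → Ω → EuclideanSpace ℝ (Fin d)}
    {Kp Km : TimeInterval T → Ω → ℝ} {D : Data F d} (h : D.IsSolution P B Y Z Kp Km) :
    D.IsStandardSolution P B Y Z Kp Km := by
  have hY : IsD F Y := h.mem_dom.1
  obtain ⟨-, hYL, hYl, hYU, hYu⟩ := D.mem_Dom_iff.1 h.mem_dom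
  refine ⟨h.equation, (D.mem_Dom_iff_barriers hY).1 h.mem_dom, ?_, ?_, hY, h.isK_plus,
    h.isK_minus, h.isL2, h.singular⟩
  · have key := ae_leftValue_le_max_envelope hver hY D.isD_L D.predictable_l D.isK_δ h.isK_plus
      hYl (fun X hX hXY hmin hXl => by
        -- Lying below `Y` gives the two upper constraints, and lying above `min Y L` the one from
        -- `L`.
        have hXdom : X ∈ D.Dom P := by
          refine D.mem_Dom_iff.2 ⟨hX, ?_, hXl, ?_, ?_⟩
          · filter_upwards [hYL] with ω hω
            filter_upwards [hω] with t ht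
            exact (le_min ht le_rfl).trans (hmin t ω)
          · filter_upwards [hYU] with ω hω
            filter_upwards [hω] with t ht
            exact (hXY t ω).trans ht
          · filter_upwards [hYu] with ω hω
            filter_upwards [hω] with t ht
            exact (hXY t ω).trans ht
        exact ((minimality_iff hY hX h.isK_plus h.isK_minus).1 (h.minimality X hXdom)).1)
    filter_upwards [key] with ω hω
    exact (D.lintegral_sub_lowerBarrier_eq_zero_iff hY ω).2 hω
  -- Mirror image: `-Y` is lowered towards `-U ∨ r`, with `dα` and `dK⁻` in place of `dδ` and `dK⁺`.
  · have key := ae_leftValue_le_max_envelope (h := fun s ω => -D.u s ω) hver hY.neg D.isD_U.neg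
      (StronglyMeasurable.neg D.predictable_u) D.isK_α h.isK_minus
      (by
        filter_upwards [hYu] with ω hω
        filter_upwards [hω] with t ht
        rw [hY.leftValue_neg]
        exact neg_le_neg ht)
      (fun X hX hXY hmin hXu => by
        simp only [hY.leftValue_neg, D.isD_U.leftValue_neg] at hXY hmin
        have hXdom : (fun t ω => -X t ω) ∈ D.Dom P := by
          refine D.mem_Dom_iff.2 ⟨hX.neg, ?_, ?_, ?_, ?_⟩
          · filter_upwards [hYL] with ω hω
            filter_upwards [hω] with t ht
            rw [hX.leftValue_neg]
            linarith [hXY t ω]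
          · filter_upwards [hYl] with ω hω
            filter_upwards [hω] with t ht
            rw [hX.leftValue_neg]
            linarith [hXY t ω]
          · filter_upwards [hYU] with ω hω
            filter_upwards [hω] with t ht
            rw [hX.leftValue_neg]
            linarith [(le_min (neg_le_neg ht) le_rfl).trans (hmin t ω)]
          · filter_upwards [hXu] with ω hω
            filter_upwards [hω] with t ht
            rw [hX.leftValue_neg]
            linarith
        filter_upwards [((minimality_iff hY hX.neg h.isK_plus h.isK_minus).1
          (h.minimality _ hXdom)).2] with ω hω
        filter_upwards [hω] with t ht
        rw [hX.leftValue_neg] at ht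
        rw [hY.leftValue_neg]
        linarith)
    filter_upwards [key] with ω hω
    refine (D.lintegral_upperBarrier_sub_eq_zero_iff hY ω).2 ?_
    filter_upwards [hω] with t ht
    rw [hY.leftValue_neg, D.isD_U.leftValue_neg, le_max_iff, EReal.coe_neg, EReal.coe_neg,
      EReal.neg_le_neg_iff] at ht
    rw [upperBarrier, min_le_iff]
    exact ht.imp_right EReal.neg_le.1

end Data

end Comparison

end RBSDE

/-- The Brownian structure enters only through the continuity of the martingales `P(A | F_t)`, and
only for the direct implication. -/
theorem mainTheorem5 {Ω : Type*} [MeasurableSpace Ω] (P : Measure Ω) [IsProbabilityMeasure P]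
    [P.IsComplete] {T : ℝ} [Fact (0 ≤ T)] {d : ℕ}
    (B : RBSDE.TimeInterval T → Ω → EuclideanSpace ℝ (Fin d))
    (hB : RBSDE.IsBrownianMotion P B)
    (D : RBSDE.Data (RBSDE.augmentedFiltration P B hB.measurable) d)
    (Y : RBSDE.TimeInterval T → Ω → ℝ)
    (Z : RBSDE.TimeInterval T → Ω → EuclideanSpace ℝ (Fin d))
    (Kp Km : RBSDE.TimeInterval T → Ω → ℝ) :
    D.IsSolution P B Y Z Kp Km ↔ D.IsStandardSolution P B Y Z Kp Km :=
  ⟨fun h => h.isStandardSolution fun _ hA => RBSDE.exists_isContinuousVersion hB hA,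
    fun h => h.isSolution⟩
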